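/- **Setting.** Let $S$ be the set of finite binary strings, $\Omega$ the set of infinite binary sequences, $\lambda$ the empty string, and order $S\cup\Omega$ by the prefix relation $\sqsubseteq$ and $(S\cup\Omega)^2$ componentwise. For $\mathbf x\in S^2$ let $\Delta(\mathbf x)=\{\mathbf w\in\Omega^2:\mathbf x\sqsubseteq\mathbf w\}$, and for $A\subseteq S^2$ let $\tilde A=\bigcup_{\mathbf x\in A}\Delta(\mathbf x)$. Logarithms are to base $2$, with $\log 0=-\infty$; "r.e." means recursively enumerable. A probability $P$ on $\Omega^2$ (with the product $\sigma$-algebra), with $P(\mathbf x):=P(\Delta(\mathbf x))$, is *computable* if some computable $p:S^2\times\mathbb N\to\mathbb Q$ satisfies $|P(\mathbf x)-p(\mathbf x,k)|<1/k$ for all $\mathbf x\in S^2$, $k\ge1$. A *test* is an r.e. set $U\subseteq\mathbb N\times S^2$ whose sections $U_n$ satisfy $\tilde U_{n+1}\subseteq\tilde U_n$ and $P(\tilde U_n)<2^{-n}$ for all $n\ge1$. The set $\mathcal R^P\subseteq\Omega^2$ of random points consists of the points that lie in $\bigcap_{n\ge1}\tilde U_n$ for no test $U$ (this is the complement of $\bigcap_{n\ge1}\tilde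 U_n$ for any universal test $U$). Say that $F\subseteq S^2\times S^2$ satisfies (M) if for every $\mathbf p\in S^2$ we have $(\mathbf p,(\lambda,\lambda))\in F$ and the least upper bound $\bigvee\{\mathbf x:(\mathbf p',\mathbf x)\in F,\ \mathbf p'\sqsubseteq\mathbf p\}$ exists in $(S\cup\Omega)^2$. Fix an r.e. set $\bar F\subseteq\mathbb N\times S^2\times S^2$ whose sections $F_i$ all satisfy (M) and include every r.e. set that satisfies (M) (such an $\bar F$ exists). Let $F^u=\{((0^i1p_1,p_2),\mathbf x):(i,(p_1,p_2),\mathbf x)\in\bar F\}$ and let $u:(S\cup\Omega)^2\to(S\cup\Omega)^2$ be the (optimal) monotone function $$u(\mathbf p)=\bigvee\{\mathbf x:(\mathbf p',\mathbf x)\in F^u,\ \mathbf p'\in S^2,\ \mathbf p'\sqsubseteq\mathbf p\}.$$ For $x,y\in S\cup\Omega$ define, with $\min\emptyset=\infty$ and $|p|=\infty$ for $p\in\Omega$, $$Km^2(x,y)=\min\{|p_1|+|p_2|:(x,y)\sqsubseteq u(p_1,p_2)\},\qquad Km(x,y)=\min\{|p|:(x,y)\sqsubseteq u(p,\lambda)\},$$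 $$Km(x|y)=\min\{|p|:(x,\lambda)\sqsubseteq u(p,y)\},\qquad Km(x)=Km(x|\lambda).$$ A set $\alpha\subseteq S^2$ is *non-overlapping* if distinct elements $\mathbf x,\mathbf y\in\alpha$ have $\Delta(\mathbf x)\cap\Delta(\mathbf y)=\emptyset$. For $\mathcal A\subseteq S^2$ and $\mathbf x^\infty\in\Omega^2$ let $\mathcal A(\mathbf x^\infty)=\{\mathbf x\in\mathcal A:\mathbf x\sqsubset\mathbf x^\infty\}$. **Statement.** Let $P$ be a computable probability on $\Omega^2$, and let $\mathcal A\subseteq S^2$ be decidable and such that for all $\mathbf x,\mathbf y\in\mathcal A$: (1) $\mathbf x$ and $\mathbf y$ are comparable or $\Delta(\mathbf x)\cap\Delta(\mathbf y)=\emptyset$; (2) there is a non-overlapping $\alpha\subseteq\mathcal A$ with $\Delta(\mathbf x)\setminus\Delta(\mathbf y)=\tilde\alpha$. Then for every $\mathbf x^\infty\in\Omega^2$: (a) if $\mathbf x^\infty\in\mathcal R^P$, then $\sup_{\mathbf x\in\mathcal A(\mathbf x^\infty)}|\log P(\mathbf x)+Km(\mathbf x)|<\infty$; (b) if $\sup_{\mathbf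 x\in\mathcal A(\mathbf x^\infty)}|\log P(\mathbf x)+Km(\mathbf x)|<\infty$ and $\mathbf x^\infty=\bigvee\mathcal A(\mathbf x^\infty)$, then $\mathbf x^\infty\in\mathcal R^P$; (c) (a) and (b) also hold with $Km^2$ in place of $Km$; (d) if $\mathbf x^\infty\in\mathcal R^P$, then $\sup_{\mathbf x\in\mathcal A(\mathbf x^\infty)}|Km(\mathbf x)-Km^2(\mathbf x)|<\infty$; (e) if $\sup_{\mathbf x\in\mathcal A(\mathbf x^\infty)}|Km(\mathbf x)-Km^2(\mathbf x)|<\infty$, then $\sup_{(x,y)\in\mathcal A(\mathbf x^\infty)}\bigl(Km(x,y)-Km(x|y)-Km(y)\bigr)<\infty$. In particular, by (d), this holds for every $\mathbf x^\infty\in\mathcal R^P$. -/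

import Mathlib

open MeasureTheory Set
open scoped ENNReal

namespace ProductKm

/-! ### Finite and infinite binary words, the prefix order, cylinders -/

/-- Infinite binary sequences; `Omega × Omega` carries Mathlib's product `σ`-algebra. -/
abbrev Omega : Type := ℕ → Bool

/-- Pairs of finite binary strings. -/
abbrev S2 : Type := List Bool × List Bool

/-- `S ∪ Ω`: finite or infinite binary words. -/
inductive Word : Type
  | fin (s : List Bool) : Word
  | inf (w : Omega) : Word

namespace Word

/-- The `i`-th letter of a word, if there is one. -/
def letter : Word → ℕ → Option Bool
  | fin s, i => s[i]?
  | inf w, i => some (w i)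

/-- The length `|x|`, which is `∞` for an infinite word. -/
def length : Word → ℕ∞
  | fin s => (s.length : ℕ∞)
  | inf _ => ⊤

/-- The prefix relation `x ⊑ y`. -/
def IsPrefix : Word → Word → Prop
  | fin s, fin t => s <+: t
  | fin s, inf w => ∀ (i : ℕ) (h : i < s.length), s[i] = w i
  | inf _, fin _ => False
  | inf w, inf w' => w = w'

theorem isPrefix_iff (x y : Word) :
    x.IsPrefix y ↔ ∀ i b, x.letter i = some b → y.letter i = some b := by
  rcases x with s | w <;> rcases y with t | v
  · simp only [IsPrefix, letter]
    constructor
    · rintro ⟨r, rfl⟩ i b h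
      obtain ⟨hi, rfl⟩ := List.getElem?_eq_some_iff.1 h
      rw [List.getElem?_append_left hi, h]
    · intro h
      rw [List.prefix_iff_getElem?]
      intro i hi
      exact h i _ (List.getElem?_eq_getElem hi)
  · simp only [IsPrefix, letter]
    constructor
    · intro h i b hb
      obtain ⟨hi, rfl⟩ := List.getElem?_eq_some_iff.1 hb
      rw [h i hi]
    · intro h i hi
      have := h i _ (List.getElem?_eq_getElem hi)
      simpa using this.symm
  · simp only [IsPrefix, letter, false_iff]
    intro h
    have := h t.length _ rfl
    simp at this
  · simp only [IsPrefix, letter]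
    constructor
    · rintro rfl i b h
      exact h
    · intro h
      funext i
      simpa using (h i _ rfl).symm

theorem letter_injective : Function.Injective letter := by
  rintro (s | w) (t | v) h
  · congr 1
    exact List.ext_getElem? fun i => congrFun h i
  · have := congrFun h s.length
    simp [letter] at this
  · have := congrFun h t.length
    simp [letter] at this
  · congr 1
    funext i
    simpa [letter] using congrFun h i

/-- Words are partially ordered by the prefix relation; pairs of words are ordered
componentwise (Mathlib's order on a product). -/
instance : PartialOrder Word where
  le := IsPrefix
  le_refl x := (isPrefix_iff x x).2 fun _ _ h => h
  le_trans x y z hxy hyz := (isPrefix_iff x z).2 fun i b h =>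
    (isPrefix_iff y z).1 hyz i b ((isPrefix_iff x y).1 hxy i b h)
  le_antisymm x y hxy hyx := letter_injective <| funext fun i => Option.ext fun b =>
    ⟨(isPrefix_iff x y).1 hxy i b, (isPrefix_iff y x).1 hyx i b⟩

theorem le_iff (x y : Word) : x ≤ y ↔ ∀ i b, x.letter i = some b → y.letter i = some b :=
  isPrefix_iff x y

theorem fin_le_fin (s t : List Bool) : fin s ≤ fin t ↔ s <+: t := Iff.rfl

end Word

/-- `(S ∪ Ω)²`. -/
abbrev Word2 : Type := Word × Word

/-- The inclusion of `S²` into `(S ∪ Ω)²`. -/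
def ofFin (x : S2) : Word2 := (Word.fin x.1, Word.fin x.2)

/-- The inclusion of `Ω²` into `(S ∪ Ω)²`. -/
def ofInf (w : Omega × Omega) : Word2 := (Word.inf w.1, Word.inf w.2)

/-- The pair `(λ, λ)` of empty words. -/
def empty2 : S2 := ([], [])

/-- `Δ(x) = Δ(x₁) × Δ(x₂)`, the pairs of infinite sequences that extend `x`. -/
def box (x : S2) : Set (Omega × Omega) := {w | ofFin x ≤ ofInf w}

/-- `Ã = ⋃_{x ∈ A} Δ(x)`. -/
def cover (A : Set S2) : Set (Omega × Omega) := ⋃ x ∈ A, box x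

/-- `A(w) = {x ∈ A | x ⊏ w}` for `w ∈ Ω²`. -/
def prefixesIn (A : Set S2) (w : Omega × Omega) : Set S2 := {x ∈ A | ofFin x ≤ ofInf w}

/-- `w` is the least upper bound of `A(w)`. -/
def IsJoinOfPrefixes (A : Set S2) (w : Omega × Omega) : Prop :=
  IsLUB (ofFin '' prefixesIn A w) (ofInf w)

/-! ### The two conditions on a family of pairs of strings -/

/-- Distinct elements have disjoint cylinders. -/
def NonOverlapping (A : Set S2) : Prop :=
  ∀ x ∈ A, ∀ y ∈ A, x ≠ y → Disjoint (box x) (box y)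

/-- Any two elements are comparable or have disjoint cylinders. -/
def ComparableOrDisjoint (A : Set S2) : Prop :=
  ∀ x ∈ A, ∀ y ∈ A, ofFin x ≤ ofFin y ∨ ofFin y ≤ ofFin x ∨ Disjoint (box x) (box y)

/-- The difference of any two cylinders from `A` is covered by a non-overlapping subset of `A`. -/
def DifferencesCovered (A : Set S2) : Prop :=
  ∀ x ∈ A, ∀ y ∈ A, ∃ a ⊆ A, NonOverlapping a ∧ box x \ box y = cover a

/-! ### Computable probabilities and Martin-Löf randomness -/

/-- `P` is computable: a computable function gives, for every `x` and `k ≥ 1`, a rational number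
(as a pair of a numerator and a denominator; as `P(x) ≥ 0`, non-negative ones suffice)
at distance less than `1/k` from `P(Δ(x))`. -/
def IsComputableProb (P : Measure (Omega × Omega)) : Prop :=
  ∃ p : S2 × ℕ → ℕ × ℕ, Computable p ∧
    ∀ (x : S2) (k : ℕ), 1 ≤ k →
      |(P (box x)).toReal - ((p (x, k)).1 : ℝ) / ((p (x, k)).2 : ℝ)| < 1 / (k : ℝ)

/-- The `n`-th section `U_n` of `U ⊆ ℕ × S²`. -/
def level (U : Set (ℕ × S2)) (n : ℕ) : Set S2 := {x | (n, x) ∈ U}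

/-- Martin-Löf tests with respect to `P` (levels are indexed by `n ≥ 1`). -/
structure IsTest (P : Measure (Omega × Omega)) (U : Set (ℕ × S2)) : Prop where
  re : REPred fun a : ℕ × S2 => a ∈ U
  nested : ∀ n, 1 ≤ n → cover (level U (n + 1)) ⊆ cover (level U n)
  small : ∀ n, 1 ≤ n → P (cover (level U n)) < (2⁻¹ : ℝ≥0∞) ^ n

/-- The null set `⋂_{n ≥ 1} Ũ_n` of a test. -/
def testLimit (U : Set (ℕ × S2)) : Set (Omega × Omega) := ⋂ n ∈ Ici 1, cover (level U n)

/-- The set `R^P` of Martin-Löf random pairs: those in the null set of no test. -/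
def randomSet (P : Measure (Omega × Omega)) : Set (Omega × Omega) :=
  {w | ∀ U, IsTest P U → w ∉ testLimit U}

/-- Universal Martin-Löf tests. -/
def IsUniversalTest (P : Measure (Omega × Omega)) (U : Set (ℕ × S2)) : Prop :=
  IsTest P U ∧ ∀ V, IsTest P V →
    ∃ c : ℕ, ∀ n, 1 ≤ n → cover (level V (n + c)) ⊆ cover (level U n)

/-- `R^P` is the complement of the null set of any universal test. -/
theorem randomSet_eq_of_universal {P : Measure (Omega × Omega)} {U : Set (ℕ × S2)}
    (hU : IsUniversalTest P U) : randomSet P = (testLimit U)ᶜ := by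
  ext w
  constructor
  · intro h
    exact h U hU.1
  · intro h V hV hw
    obtain ⟨c, hc⟩ := hU.2 V hV
    apply h
    simp only [testLimit, mem_iInter, mem_Ici] at hw ⊢
    intro n hn
    exact hc n hn (hw (n + c) (by omega))

/-! ### Monotone functions -/

/-- The pairs of strings that `F ⊆ S² × S²` assigns to finite pairs `p' ⊑ p`. -/
def outputs (F : Set (S2 × S2)) (p : Word2) : Set S2 :=
  {x | ∃ p' : S2, ofFin p' ≤ p ∧ (p', x) ∈ F}

/-- The condition on `F ⊆ S² × S²` under which it defines a monotone function:
`(λ, λ) ∈ F_p`, and `⋁_{p' ⊑ p} F_{p'}` exists, for every `p ∈ S²`. -/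
structure MonotoneCond (F : Set (S2 × S2)) : Prop where
  empty_mem : ∀ p : S2, (p, empty2) ∈ F
  join_exists : ∀ p : S2, ∃ z : Word2, IsLUB (ofFin '' outputs F (ofFin p)) z

open scoped Classical in
/-- The function `f(p) = ⋁_{p' ⊑ p, p' ∈ S²} F_{p'}` on `(S ∪ Ω)²` defined by `F`. -/
noncomputable def monotoneFun (F : Set (S2 × S2)) (p : Word2) : Word2 :=
  if h : ∃ z : Word2, IsLUB (ofFin '' outputs F p) z then h.choose else ofFin empty2

/-- `E ⊆ ℕ × S² × S²` is an r.e. set whose sections `E_i` enumerate exactly the r.e. sets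
`F ⊆ S² × S²` that satisfy `MonotoneCond`. -/
structure IsUniversalEnumeration (E : Set (ℕ × S2 × S2)) : Prop where
  re : REPred fun a : ℕ × S2 × S2 => a ∈ E
  sound : ∀ i, MonotoneCond {a | (i, a) ∈ E}
  complete : ∀ F : Set (S2 × S2), (REPred fun a : S2 × S2 => a ∈ F) → MonotoneCond F →
    ∃ i, {a | (i, a) ∈ E} = F

/-- `{((0^i 1 p₁, p₂), x) | (i, (p₁, p₂), x) ∈ E}`. -/
def optimalRel (E : Set (ℕ × S2 × S2)) : Set (S2 × S2) :=
  {a | ∃ (i : ℕ) (p x : S2), (i, p, x) ∈ E ∧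
    a = ((List.replicate i false ++ true :: p.1, p.2), x)}

/-- The optimal monotone function built from the enumeration `E`. -/
noncomputable def optimalFun (E : Set (ℕ × S2 × S2)) : Word2 → Word2 := monotoneFun (optimalRel E)

/-! ### Monotone complexities with respect to a function `u` on `(S ∪ Ω)²`

The infimum in `ℕ∞` is a minimum, and `∞` if there is no program. -/

/-- `Km²(x) = min {|p₁| + |p₂| : x ⊑ u(p₁, p₂)}`. -/
noncomputable def Km2 (u : Word2 → Word2) (x : Word2) : ℕ∞ :=
  sInf {n | ∃ p : Word2, x ≤ u p ∧ n = p.1.length + p.2.length}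

/-- `Km(x) = min {|p| : x ⊑ u(p, λ)}` for a pair `x`. -/
noncomputable def Km (u : Word2 → Word2) (x : Word2) : ℕ∞ :=
  sInf {n | ∃ p : Word, x ≤ u (p, Word.fin []) ∧ n = p.length}

/-- `Km(x | y) = min {|p| : (x, λ) ⊑ u(p, y)}`. -/
noncomputable def KmCond (u : Word2 → Word2) (x y : Word) : ℕ∞ :=
  sInf {n | ∃ p : Word, (x, Word.fin []) ≤ u (p, y) ∧ n = p.length}

/-- `Km(x) = Km(x | λ)` for a single word `x`. -/
noncomputable def Km1 (u : Word2 → Word2) (x : Word) : ℕ∞ := KmCond u x (Word.fin [])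

/-! ### Boundedness -/

/-- The logarithm to base `2`, with `log 0 = -∞`. -/
noncomputable def log2 (p : ℝ≥0∞) : EReal :=
  if p = 0 then ⊥ else ((Real.logb 2 p.toReal : ℝ) : EReal)

/-- A complexity as an extended real number. -/
noncomputable def toE (n : ℕ∞) : EReal := (((n : ℝ≥0∞)) : EReal)

/-- `sup_{x ∈ A} v(x) < ∞`. -/
def SupFinite (A : Set S2) (v : S2 → EReal) : Prop := ∃ c : ℝ, ∀ x ∈ A, v x ≤ (c : EReal)

/-- `sup_{x ∈ A} |v(x)| < ∞`; in particular `v(x) ≠ ±∞` on `A`. -/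
def SupAbsFinite (A : Set S2) (v : S2 → EReal) : Prop :=
  ∃ c : ℝ, ∀ x ∈ A, -(c : EReal) ≤ v x ∧ v x ≤ (c : EReal)

/-! ### Existence: the joins used above exist, and there is a universal enumeration -/

/-- One of the two strings is a prefix of the other. -/
def Comp1 (s t : List Bool) : Prop := s <+: t ∨ t <+: s

/-- Componentwise comparability, i.e. having a common upper bound in `(S ∪ Ω)²`. -/
def Comp2 (x y : S2) : Prop := Comp1 x.1 y.1 ∧ Comp1 x.2 y.2

theorem Comp1.of_le {s t : List Bool} {z : Word} (hs : Word.fin s ≤ z) (ht : Word.fin t ≤ z) :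
    Comp1 s t := by
  rcases z with r | w
  · rcases le_total s.length t.length with h | h
    · exact Or.inl (List.prefix_of_prefix_length_le hs ht h)
    · exact Or.inr (List.prefix_of_prefix_length_le ht hs h)
  · have hs' : ∀ (i : ℕ) (h : i < s.length), s[i] = w i := hs
    have ht' : ∀ (i : ℕ) (h : i < t.length), t[i] = w i := ht
    rcases le_total s.length t.length with h | h
    · refine Or.inl (List.prefix_iff_getElem.2 ⟨h, fun i hi => ?_⟩)
      rw [hs' i hi, ht' i (hi.trans_le h)]
    · refine Or.inr (List.prefix_iff_getElem.2 ⟨h, fun i hi => ?_⟩)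
      rw [ht' i hi, hs' i (hi.trans_le h)]

theorem Comp2.of_le {x y : S2} {z : Word2} (hx : ofFin x ≤ z) (hy : ofFin y ≤ z) : Comp2 x y :=
  ⟨Comp1.of_le hx.1 hy.1, Comp1.of_le hx.2 hy.2⟩

theorem exists_isLUB_fin (A : Set (List Bool)) (hA : ∀ s ∈ A, ∀ t ∈ A, Comp1 s t) :
    ∃ z, IsLUB (Word.fin '' A) z := by
  by_cases hb : ∀ n, ∃ s ∈ A, n < s.length
  · choose g hgA hg using hb
    refine ⟨Word.inf fun i => (g i)[i]'(hg i), ?_, ?_⟩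
    · rintro _ ⟨s, hs, rfl⟩ i hi
      rcases hA s hs (g i) (hgA i) with h | h
      · exact h.getElem hi
      · exact (h.getElem (hg i)).symm
    · intro y hy
      refine (Word.le_iff _ _).2 fun i b hb => ?_
      refine (Word.le_iff _ _).1 (hy ⟨g i, hgA i, rfl⟩) i b ?_
      simp only [Word.letter, Option.some.injEq] at hb ⊢
      rw [List.getElem?_eq_getElem (hg i), hb]
  · push Not at hb
    obtain ⟨n, hn⟩ := hb
    rcases A.eq_empty_or_nonempty with rfl | hne
    · refine ⟨Word.fin [], ?_⟩
      rw [image_empty, isLUB_empty_iff]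
      intro y
      refine (Word.le_iff _ _).2 fun i b hb => ?_
      simp [Word.letter] at hb
    · have hfin : (List.length '' A).Finite :=
        (Set.finite_Iic n).subset (by rintro _ ⟨s, hs, rfl⟩; exact hn s hs)
      obtain ⟨_, ⟨s, hs, rfl⟩, hmax⟩ := hfin.exists_maximal (hne.image _)
      refine ⟨Word.fin s, IsGreatest.isLUB ⟨⟨s, hs, rfl⟩, ?_⟩⟩
      rintro _ ⟨t, ht, rfl⟩
      rcases hA t ht s hs with h | h
      · exact h
      · have h2 : t.length ≤ s.length := hmax ⟨t, ht, rfl⟩ h.length_le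
        exact (Word.fin_le_fin _ _).2 (h.eq_of_length_le h2 ▸ List.prefix_rfl)

theorem exists_isLUB_ofFin (A : Set S2) (hA : ∀ x ∈ A, ∀ y ∈ A, Comp2 x y) :
    ∃ z, IsLUB (ofFin '' A) z := by
  obtain ⟨z1, h1⟩ := exists_isLUB_fin (Prod.fst '' A) (by
    rintro _ ⟨x, hx, rfl⟩ _ ⟨y, hy, rfl⟩; exact (hA x hx y hy).1)
  obtain ⟨z2, h2⟩ := exists_isLUB_fin (Prod.snd '' A) (by
    rintro _ ⟨x, hx, rfl⟩ _ ⟨y, hy, rfl⟩; exact (hA x hx y hy).2)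
  refine ⟨(z1, z2), isLUB_prod.2 ⟨?_, ?_⟩⟩
  · rw [image_image] at h1 ⊢
    exact h1
  · rw [image_image] at h2 ⊢
    exact h2

/-- Compatible inputs are assigned compatible outputs. -/
def Consistent (F : Set (S2 × S2)) : Prop :=
  ∀ a ∈ F, ∀ b ∈ F, Comp2 a.1 b.1 → Comp2 a.2 b.2

theorem Consistent.exists_isLUB {F : Set (S2 × S2)} (hF : Consistent F) (p : Word2) :
    ∃ z, IsLUB (ofFin '' outputs F p) z := by
  refine exists_isLUB_ofFin _ ?_
  rintro x ⟨q, hq, hx⟩ y ⟨r, hr, hy⟩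
  exact hF _ hx _ hy (Comp2.of_le hq hr)

theorem Consistent.isLUB {F : Set (S2 × S2)} (hF : Consistent F) (p : Word2) :
    IsLUB (ofFin '' outputs F p) (monotoneFun F p) := by
  have h := hF.exists_isLUB p
  rw [monotoneFun, dif_pos h]
  exact h.choose_spec

theorem Comp1.exists_join {s t : List Bool} (h : Comp1 s t) :
    ∃ r, Word.fin s ≤ Word.fin r ∧ Word.fin t ≤ Word.fin r := by
  rcases h with h | h
  · exact ⟨t, h, le_refl _⟩
  · exact ⟨s, le_refl _, h⟩

theorem monotoneCond_iff (F : Set (S2 × S2)) :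
    MonotoneCond F ↔ (∀ p : S2, (p, empty2) ∈ F) ∧ Consistent F := by
  constructor
  · intro h
    refine ⟨h.empty_mem, fun a ha b hb hab => ?_⟩
    obtain ⟨r1, h1, h1'⟩ := hab.1.exists_join
    obtain ⟨r2, h2, h2'⟩ := hab.2.exists_join
    obtain ⟨z, hz⟩ := h.join_exists (r1, r2)
    exact Comp2.of_le (hz.1 ⟨a.2, ⟨a.1, ⟨h1, h2⟩, ha⟩, rfl⟩) (hz.1 ⟨b.2, ⟨b.1, ⟨h1', h2'⟩, hb⟩, rfl⟩)
  · rintro ⟨h0, h⟩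
    exact ⟨h0, fun p => h.exists_isLUB _⟩

theorem comp1_code {i j : ℕ} {s t : List Bool}
    (h : Comp1 (List.replicate i false ++ true :: s) (List.replicate j false ++ true :: t)) :
    i = j ∧ Comp1 s t := by
  induction i generalizing j with
  | zero =>
    cases j with
    | zero => simpa [Comp1] using h
    | succ j => simp [Comp1, List.replicate_succ] at h
  | succ i ih =>
    cases j with
    | zero => simp [Comp1, List.replicate_succ] at h
    | succ j =>
      have := @ih j (by simpa [Comp1, List.replicate_succ] using h)
      exact ⟨by rw [this.1], this.2⟩

/-- The joins that define the optimal function exist. -/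
theorem optimalFun_isLUB {E : Set (ℕ × S2 × S2)} (hE : IsUniversalEnumeration E) (p : Word2) :
    IsLUB (ofFin '' outputs (optimalRel E) p) (optimalFun E p) := by
  refine Consistent.isLUB ?_ p
  rintro _ ⟨i, q, x, hx, rfl⟩ _ ⟨j, r, y, hy, rfl⟩ ⟨h1, h2⟩
  obtain ⟨rfl, h3⟩ := comp1_code h1
  exact ((monotoneCond_iff _).1 (hE.sound i)).2 (q, x) hx (r, y) hy ⟨h3, h2⟩

open Nat.Partrec in
/-- The `m`-th pair listed by the `i`-th partial recursive function, seen as the enumeration of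
its domain (`(λ, λ)` if nothing is listed at step `m`). -/
def listed (i m : ℕ) : S2 × S2 :=
  ((Code.evaln m.unpair.1 (Denumerable.ofNat Code i) m.unpair.2).bind
    fun _ => (Encodable.decode m.unpair.2 : Option (S2 × S2))).getD (empty2, empty2)

open Primrec in
theorem listed_primrec : Primrec₂ listed := by
  refine Primrec.option_getD.comp (Primrec.option_bind ?_ ?_) (Primrec.const _)
  · exact Nat.Partrec.Code.primrec_evaln.comp
      (((Primrec.fst.comp (Primrec.unpair.comp Primrec.snd)).pair
        ((Primrec.ofNat _).comp Primrec.fst)).pair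
        (Primrec.snd.comp (Primrec.unpair.comp Primrec.snd)))
  · exact Primrec.decode.comp (Primrec.snd.comp (Primrec.unpair.comp
      (Primrec.snd.comp Primrec.fst)))

theorem comp1_primrec : PrimrecRel Comp1 := by
  have h : PrimrecRel fun s t : List Bool => s <+: t := by
    refine PrimrecPred.of_eq (p := fun a : List Bool × List Bool => a.1 = a.2.take a.1.length)
      (Primrec.eq.comp Primrec.fst (Primrec.list_take.comp
        (Primrec.list_length.comp Primrec.fst) Primrec.snd)) fun a => ?_
    exact List.prefix_iff_eq_take.symm
  exact PrimrecPred.or (h.comp Primrec.fst Primrec.snd) (h.comp Primrec.snd Primrec.fst)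

theorem comp2_primrec : PrimrecRel Comp2 :=
  PrimrecPred.and
    (comp1_primrec.comp (Primrec.fst.comp Primrec.fst) (Primrec.fst.comp Primrec.snd))
    (comp1_primrec.comp (Primrec.snd.comp Primrec.fst) (Primrec.snd.comp Primrec.snd))

/-- Compatible inputs are assigned compatible outputs by `a` and `b`. -/
def Agree (a b : S2 × S2) : Prop := Comp2 a.1 b.1 → Comp2 a.2 b.2

theorem agree_primrec : PrimrecRel Agree := by
  refine PrimrecPred.of_eq (p := fun c : (S2 × S2) × (S2 × S2) =>
    ¬ Comp2 c.1.1 c.2.1 ∨ Comp2 c.1.2 c.2.2) ?_ fun c => ?_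
  · exact PrimrecPred.or (PrimrecPred.not (comp2_primrec.comp
      (Primrec.fst.comp Primrec.fst) (Primrec.fst.comp Primrec.snd)))
      (comp2_primrec.comp (Primrec.snd.comp Primrec.fst) (Primrec.snd.comp Primrec.snd))
  · unfold Agree
    tauto

/-- The first `m + 1` pairs listed for `i` agree with each other. -/
def Good (i m : ℕ) : Prop :=
  ∀ k ∈ List.range (m + 1), ∀ l ∈ List.range (m + 1), Agree (listed i k) (listed i l)

theorem good_primrec : PrimrecRel Good := by
  have h1 : PrimrecRel fun (l : ℕ) (b : ℕ × ℕ × ℕ) => Agree (listed b.2.1 b.1) (listed b.2.1 l) :=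
    agree_primrec.comp
      (listed_primrec.comp (Primrec.fst.comp (Primrec.snd.comp Primrec.snd))
        (Primrec.fst.comp Primrec.snd))
      (listed_primrec.comp (Primrec.fst.comp (Primrec.snd.comp Primrec.snd)) Primrec.fst)
  have h2 : PrimrecRel fun (k : ℕ) (b : ℕ × ℕ) =>
      ∀ l ∈ List.range (b.2 + 1), Agree (listed b.1 k) (listed b.1 l) :=
    h1.forall_mem_list.comp
      (Primrec.list_range.comp (Primrec.succ.comp (Primrec.snd.comp Primrec.snd)))
      Primrec.id
  exact h2.forall_mem_list.comp
    (Primrec.list_range.comp (Primrec.succ.comp Primrec.snd)) Primrec.id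

theorem rePred_exists {α : Type} [Primcodable α] {R : α → ℕ → Prop} (hR : PrimrecRel R) :
    REPred fun a => ∃ n, R a n := by
  classical
  have h : Computable₂ fun (a : α) (n : ℕ) => if R a n then some () else none :=
    (Primrec.ite (c := fun x : α × ℕ => R x.1 x.2) hR (Primrec.const (some ()))
      (Primrec.const none)).to_comp
  refine (Partrec.rfindOpt h).dom_re.of_eq fun a => ?_
  rw [Nat.rfindOpt_dom]
  simp

/-- A universal enumeration exists. -/
theorem exists_universalEnumeration : ∃ E : Set (ℕ × S2 × S2), IsUniversalEnumeration E := by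
  refine ⟨{a | ∃ m, a.2.2 = empty2 ∨ (listed a.1 m = a.2 ∧ Good a.1 m)}, ?_, ?_, ?_⟩
  · refine rePred_exists (R := fun (a : ℕ × S2 × S2) m =>
      a.2.2 = empty2 ∨ (listed a.1 m = a.2 ∧ Good a.1 m)) ?_
    refine PrimrecPred.or ?_ (PrimrecPred.and ?_ ?_)
    · exact Primrec.eq.comp (Primrec.snd.comp (Primrec.snd.comp Primrec.fst)) (Primrec.const _)
    · exact Primrec.eq.comp (listed_primrec.comp (Primrec.fst.comp Primrec.fst) Primrec.snd)
        (Primrec.snd.comp Primrec.fst)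
    · exact good_primrec.comp (Primrec.fst.comp Primrec.fst) Primrec.snd
  · intro i
    refine (monotoneCond_iff _).2 ⟨fun p => ⟨0, Or.inl rfl⟩, ?_⟩
    have e1 : ∀ x, Comp2 empty2 x := fun x => ⟨Or.inl List.nil_prefix, Or.inl List.nil_prefix⟩
    have e2 : ∀ x, Comp2 x empty2 := fun x => ⟨Or.inr List.nil_prefix, Or.inr List.nil_prefix⟩
    rintro ⟨p, x⟩ ⟨m, hm⟩ ⟨q, y⟩ ⟨n, hn⟩
    rcases hm with hm | ⟨hm, gm⟩
    · simp only at hm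
      subst hm
      exact fun _ => e1 _
    rcases hn with hn | ⟨hn, gn⟩
    · simp only at hn
      subst hn
      exact fun _ => e2 _
    change Agree (p, x) (q, y)
    simp only at hm hn gm gn
    rw [← hm, ← hn]
    rcases le_total m n with h | h
    · exact gn m (by simp; omega) n (by simp)
    · exact gm m (by simp) n (by simp; omega)
  · intro F hF hF1
    have hcons := (monotoneCond_iff F).1 hF1
    obtain ⟨c, hc⟩ := Nat.Partrec.Code.exists_code.1 hF
    have key : ∀ a : S2 × S2, a ∈ F ↔ ∃ k, (Nat.Partrec.Code.evaln k c (Encodable.encode a)).isSome := by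
      intro a
      have h1 : (Nat.Partrec.Code.eval c (Encodable.encode a)).Dom ↔ a ∈ F := by
        rw [hc]
        simp [Part.assert]
      rw [← h1, Part.dom_iff_mem]
      simp only [Nat.Partrec.Code.evaln_complete, Option.isSome_iff_exists]
      exact exists_comm
    have hl : ∀ m, listed (Encodable.encode c) m ∈ F := by
      intro m
      unfold listed
      rw [Denumerable.ofNat_encode]
      cases h : Nat.Partrec.Code.evaln m.unpair.1 c m.unpair.2 with
      | none => exact hcons.1 _
      | some v =>
        cases h' : (Encodable.decode m.unpair.2 : Option (S2 × S2)) with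
        | none => simpa [h'] using hcons.1 _
        | some a =>
          simp only [Option.bind_some, Option.getD_some]
          have h2 : m.unpair.2 ∈ Part.some m.unpair.2 := Part.mem_some _
          have h3 : (Nat.Partrec.Code.eval c m.unpair.2).Dom :=
            Part.dom_iff_mem.2 ⟨v, Nat.Partrec.Code.evaln_sound h⟩
          rw [hc] at h3
          simpa [h', Part.assert] using h3
    refine ⟨Encodable.encode c, Set.ext fun a => ⟨?_, fun ha => ?_⟩⟩
    · rintro ⟨m, hm | ⟨hm, -⟩⟩
      · have := hcons.1 a.1
        rw [← (show a.2 = empty2 from hm)] at this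
        exact this
      · simp only at hm
        rw [← hm]
        exact hl m
    · obtain ⟨k, hk⟩ := (key a).1 ha
      obtain ⟨v, hv⟩ := Option.isSome_iff_exists.1 hk
      refine ⟨Nat.pair k (Encodable.encode a), Or.inr ⟨?_, fun k _ l _ => hcons.2 _ (hl k) _ (hl l)⟩⟩
      simp [listed, hv]

end ProductKm

open ProductKm

/-! Everything rests on comparing `Km` and `Km²` with `-log P` from both sides.

Upper bound, for every element of `A`: since elements of `A` are comparable or disjoint, the
prefixes in `A` of a given element form a finite chain, so `A` is a forest. Ordering siblings by
their codes gives a left-to-right order. Put `x` on the interval of length `P(x)` whose left end is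
the total measure of the boxes to the left of `x`. This is a finite sum, hence computable, and
incomparable elements get disjoint intervals (`leftOf_total`). A dyadic word whose interval lies
inside that of `x` serves as a program (`exists_Km_le_of_intervals`), whence `Km(x) ≤ -log P(x) + c`
(`exists_Km_le_neg_log`).

Lower bound, along random points: collect the `x ∈ A` that have a pair of programs much shorter than
`-log P(x)`. Minimal such `x` have disjoint boxes, and by monotonicity of `u` so have their
programs; the uniform measure of the programs therefore bounds the `P`-measure of the collection,
which makes it a test (`measure_cover_deficient`). This treats `Km²` directly. As `Km² ≤ Km`, both
complexities are squeezed between the two bounds, and their difference is bounded too.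

Converse: if `w` fails a test, give the minimal elements of `A` caught at level `2(n+1)` intervals
of length `2^n P(x)`. The total is at most `1`, so these elements have programs about `n` bits
shorter than `-log P(x)`; since `w` is the join of its prefixes in `A`, one of them lies below `w`
for every `n` (`exists_short_programs`).

For the conditional complexity, feeding the output of one program as condition to another is itself
a monotone function, so `Km²(x, y) ≤ Km(x|y) + Km(y) + c` (`exists_Km2_le_chain`), and the assumed
bound replaces `Km²` by `Km`. -/

section Computability

variable {α β γ : Type*} [Primcodable α] [Primcodable β] [Primcodable γ]

/-! ### Closure properties of decidable and enumerable predicates. -/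

namespace ComputablePred

protected theorem comp {p : β → Prop} {f : α → β} (hp : ComputablePred p) (hf : Computable f) :
    ComputablePred fun a => p (f a) := by
  obtain ⟨g, hg, rfl⟩ := computable_iff.1 hp
  exact computable_iff.2 ⟨_, hg.comp hf, rfl⟩

protected theorem and {p q : α → Prop} (hp : ComputablePred p) (hq : ComputablePred q) :
    ComputablePred fun a => p a ∧ q a := by
  obtain ⟨f, hf, rfl⟩ := computable_iff.1 hp
  obtain ⟨g, hg, rfl⟩ := computable_iff.1 hq
  exact computable_iff.2 ⟨_, Primrec.and.to_comp.comp hf hg, by simp⟩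

protected theorem or {p q : α → Prop} (hp : ComputablePred p) (hq : ComputablePred q) :
    ComputablePred fun a => p a ∨ q a := by
  obtain ⟨f, hf, rfl⟩ := computable_iff.1 hp
  obtain ⟨g, hg, rfl⟩ := computable_iff.1 hq
  exact computable_iff.2 ⟨_, Primrec.or.to_comp.comp hf hg, by simp⟩

protected theorem imp {p q : α → Prop} (hp : ComputablePred p) (hq : ComputablePred q) :
    ComputablePred fun a => p a → q a :=
  (hp.not.or hq).of_eq fun _ => by tauto

theorem exists_lt {p : α → ℕ → Prop} {N : α → ℕ} (hN : Computable N)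
    (hp : ComputablePred fun x : α × ℕ => p x.1 x.2) :
    ComputablePred fun a => ∃ n < N a, p a n := by
  obtain ⟨f, hf, hpf⟩ := computable_iff.1 hp
  have key : ∀ a n, p a n ↔ f (a, n) = true := fun a n => by
    simpa using congrFun hpf (a, n)
  have hc : Computable₂ fun (a : α) (x : ℕ × Bool) => x.2 || f (a, x.1) :=
    Primrec.or.to_comp.comp (Computable.snd.comp Computable.snd)
      (hf.comp (Computable.fst.pair (Computable.fst.comp Computable.snd)))
  refine computable_iff.2 ⟨_, Computable.nat_rec hN (Computable.const false) hc, ?_⟩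
  have main : ∀ a m, (∃ n < m, p a n) ↔
      (Nat.rec (motive := fun _ => Bool) false (fun n b => b || f (a, n)) m) = true := by
    intro a m
    induction m with
    | zero => simp
    | succ m ih =>
      rw [Bool.or_eq_true, ← ih, ← key]
      constructor
      · rintro ⟨n, hn, h⟩
        rcases Nat.lt_succ_iff_lt_or_eq.1 hn with h' | rfl
        · exact Or.inl ⟨n, h', h⟩
        · exact Or.inr h
      · rintro (⟨n, hn, h⟩ | h)
        · exact ⟨n, by omega, h⟩
        · exact ⟨m, by omega, h⟩
  exact funext fun a => propext (main a (N a))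

end ComputablePred

theorem Computable.ite {p : α → Prop} [DecidablePred p] {f g : α → β} (hp : ComputablePred p)
    (hf : Computable f) (hg : Computable g) : Computable fun a => if p a then f a else g a :=
  (Computable.cond hp.decide hf hg).of_eq fun a => by by_cases h : p a <;> simp [h]

theorem Computable.sum_range {f : α → ℕ → ℕ} {N : α → ℕ} (hN : Computable N)
    (hf : Computable fun x : α × ℕ => f x.1 x.2) :
    Computable fun a => ∑ n ∈ Finset.range (N a), f a n := by
  refine (Computable.nat_rec (f := N) (g := fun _ : α => 0) (h := fun a x => x.2 + f a x.1)
    hN (Computable.const 0) (Primrec.nat_add.to_comp.comp (Computable.snd.comp Computable.snd)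
      (hf.comp (Computable.fst.pair (Computable.fst.comp Computable.snd))))).of_eq fun a => ?_
  generalize N a = m
  induction m with
  | zero => rfl
  | succ m ih => rw [Finset.sum_range_succ, ← ih]

theorem Primrec.two_pow : Primrec fun n : ℕ => 2 ^ n := by
  refine (Primrec.nat_rec₁ (f := fun _ b => 2 * b) 1
    (Primrec.nat_double.comp Primrec.snd)).of_eq fun n => ?_
  induction n with
  | zero => rfl
  | succ n ih => rw [pow_succ, ← ih, mul_comm]

/-- Halting of a code means halting within some number of steps, and the step-bounded evaluation is
decidable. This normal form is how all enumerable sets below are handled. -/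
theorem rePred_iff_exists {p : α → Prop} : REPred p ↔
    ∃ R : α → ℕ → Prop, ComputablePred (fun x : α × ℕ => R x.1 x.2) ∧ ∀ a, p a ↔ ∃ n, R a n := by
  classical
  constructor
  · intro hp
    obtain ⟨c, hc⟩ := Nat.Partrec.Code.exists_code.1 hp
    refine ⟨fun a k => (Nat.Partrec.Code.evaln k c (Encodable.encode a)).isSome, ?_, fun a => ?_⟩
    · refine ComputablePred.computable_iff.2 ⟨_, (Primrec.option_isSome.comp
        (Nat.Partrec.Code.primrec_evaln.comp ((Primrec.snd.pair (Primrec.const c)).pair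
          (Primrec.encode.comp Primrec.fst)))).to_comp, rfl⟩
    · have h1 : (Nat.Partrec.Code.eval c (Encodable.encode a)).Dom ↔ p a := by
        rw [hc]
        simp [Part.assert]
      rw [← h1, Part.dom_iff_mem]
      simp only [Nat.Partrec.Code.evaln_complete, Option.isSome_iff_exists]
      exact exists_comm
  · rintro ⟨R, hR, h⟩
    have h1 : Computable₂ fun (a : α) (n : ℕ) => if R a n then some () else none :=
      Computable.ite (p := fun x : α × ℕ => R x.1 x.2) hR (Computable.const (some ()))
        (Computable.const none)
    refine (Partrec.rfindOpt h1).dom_re.of_eq fun a => ?_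
    rw [Nat.rfindOpt_dom, h]
    simp

namespace REPred

protected theorem comp {p : β → Prop} {f : α → β} (hp : REPred p) (hf : Computable f) :
    REPred fun a => p (f a) :=
  Partrec.comp hp hf

protected theorem ex {p : α → β → Prop} (hp : REPred fun x : α × β => p x.1 x.2) :
    REPred fun a => ∃ b, p a b := by
  obtain ⟨R, hR, h⟩ := rePred_iff_exists.1 hp
  -- Dovetailing: one bound `n` covers both the code of `b` and the witness stage `k`.
  refine rePred_iff_exists.2 ⟨fun a n => ∃ m < n, ∃ k < n,
    ∃ b, (Encodable.decode m : Option β) = some b ∧ R (a, b) k, ?_, fun a => ?_⟩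
  · refine ComputablePred.exists_lt Computable.snd
      (ComputablePred.exists_lt (Computable.snd.comp Computable.fst) ?_)
    obtain ⟨f, hf, hRf⟩ := ComputablePred.computable_iff.1 hR
    refine ComputablePred.computable_iff.2 ⟨fun x : ((α × ℕ) × ℕ) × ℕ =>
      ((Encodable.decode x.1.2 : Option β).bind fun b => some (f ((x.1.1.1, b), x.2))).getD false,
      ?_, ?_⟩
    · refine Computable.option_getD (Computable.option_bind
        (Computable.decode.comp (Computable.snd.comp Computable.fst)) ?_) (Computable.const _)
      exact Computable.option_some.comp (hf.comp (((Computable.fst.comp (Computable.fst.comp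
        (Computable.fst.comp Computable.fst))).pair Computable.snd).pair
          (Computable.snd.comp Computable.fst)))
    · funext x
      have key : ∀ b, R (x.1.1.1, b) x.2 ↔ f ((x.1.1.1, b), x.2) = true := fun b => by
        simpa using congrFun hRf ((x.1.1.1, b), x.2)
      simp only [key]
      cases (Encodable.decode x.1.2 : Option β) <;> simp
  · constructor
    · rintro ⟨b, hb⟩
      obtain ⟨k, hk⟩ := (h (a, b)).1 hb
      exact ⟨max (Encodable.encode b) k + 1, Encodable.encode b, by omega, k, by omega, b,
        Encodable.encodek b, hk⟩
    · rintro ⟨n, m, -, k, -, b, -, hk⟩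
      exact ⟨b, (h (a, b)).2 ⟨k, hk⟩⟩

protected theorem and {p q : α → Prop} (hp : REPred p) (hq : REPred q) :
    REPred fun a => p a ∧ q a := by
  obtain ⟨R, hR, h⟩ := rePred_iff_exists.1 hp
  obtain ⟨S, hS, h'⟩ := rePred_iff_exists.1 hq
  refine REPred.of_eq (p := fun a => ∃ n, ∃ m, R a n ∧ S a m) ?_ fun a => ?_
  · refine REPred.ex (REPred.ex (ComputablePred.to_re ?_))
    exact (hR.comp Computable.fst).and
      (hS.comp ((Computable.fst.comp Computable.fst).pair Computable.snd))
  · rw [h, h']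
    simp

protected theorem or {p q : α → Prop} (hp : REPred p) (hq : REPred q) :
    REPred fun a => p a ∨ q a := by
  obtain ⟨R, hR, h⟩ := rePred_iff_exists.1 hp
  obtain ⟨S, hS, h'⟩ := rePred_iff_exists.1 hq
  refine REPred.of_eq (p := fun a => ∃ n, R a n ∨ S a n) ?_ fun a => ?_
  · exact REPred.ex (ComputablePred.to_re (hR.or hS))
  · rw [h, h', exists_or]

end REPred

/-! ### Computable real-valued functions. -/

namespace ProductKm

variable (β) in
/-- The finite set of elements whose code is less than `n`. -/
noncomputable def below (n : ℕ) : Finset β :=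
  (Finset.range n).preimage Encodable.encode Encodable.encode_injective.injOn

theorem mem_below {n : ℕ} {b : β} : b ∈ below β n ↔ Encodable.encode b < n := by
  simp [below]

/-- `f` is a computable non-negative real function: natural numbers `q (a, k)` approximate
`f a * 2 ^ k` up to an error that is bounded by a computable function of `a` alone. -/
def ComputableReal (f : α → ℝ) : Prop :=
  ∃ (q : α × ℕ → ℕ) (C : α → ℕ), Computable q ∧ Computable C ∧
    ∀ a k, |f a * 2 ^ k - q (a, k)| ≤ C a

namespace ComputableReal

protected theorem comp {f : β → ℝ} {g : α → β} (hf : ComputableReal f) (hg : Computable g) :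
    ComputableReal fun a => f (g a) := by
  obtain ⟨q, C, hq, hC, h⟩ := hf
  exact ⟨fun x => q (g x.1, x.2), fun a => C (g a),
    hq.comp ((hg.comp Computable.fst).pair Computable.snd), hC.comp hg, fun a k => h _ k⟩

protected theorem zero : ComputableReal fun _ : α => 0 :=
  ⟨fun _ => 0, fun _ => 0, Computable.const _, Computable.const _, by simp⟩

protected theorem add {f g : α → ℝ} (hf : ComputableReal f) (hg : ComputableReal g) :
    ComputableReal fun a => f a + g a := by
  obtain ⟨q, C, hq, hC, h⟩ := hf
  obtain ⟨r, D, hr, hD, h'⟩ := hg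
  refine ⟨fun x => q x + r x, fun a => C a + D a, Primrec.nat_add.to_comp.comp hq hr,
    Primrec.nat_add.to_comp.comp hC hD, fun a k => ?_⟩
  push_cast
  rw [show (f a + g a) * 2 ^ k - (q (a, k) + r (a, k) : ℝ)
    = (f a * 2 ^ k - q (a, k)) + (g a * 2 ^ k - r (a, k)) by ring]
  exact (abs_add_le _ _).trans (add_le_add (h a k) (h' a k))

protected theorem nat_mul {f : α → ℝ} {c : α → ℕ} (hc : Computable c) (hf : ComputableReal f) :
    ComputableReal fun a => c a * f a := by
  obtain ⟨q, C, hq, hC, h⟩ := hf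
  refine ⟨fun x => c x.1 * q x, fun a => c a * C a,
    Primrec.nat_mul.to_comp.comp (hc.comp Computable.fst) hq,
    Primrec.nat_mul.to_comp.comp hc hC, fun a k => ?_⟩
  push_cast
  rw [show c a * f a * 2 ^ k - (c a * q (a, k) : ℝ) = c a * (f a * 2 ^ k - q (a, k)) by ring,
    abs_mul, Nat.abs_cast]
  exact mul_le_mul_of_nonneg_left (h a k) (Nat.cast_nonneg _)

protected theorem ite {p : α → Prop} [DecidablePred p] {f g : α → ℝ} (hp : ComputablePred p)
    (hf : ComputableReal f) (hg : ComputableReal g) :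
    ComputableReal fun a => if p a then f a else g a := by
  obtain ⟨q, C, hq, hC, h⟩ := hf
  obtain ⟨r, D, hr, hD, h'⟩ := hg
  refine ⟨fun x => if p x.1 then q x else r x, fun a => if p a then C a else D a,
    Computable.ite (hp.comp Computable.fst) hq hr, Computable.ite hp hC hD, fun a k => ?_⟩
  by_cases ha : p a
  · simpa only [if_pos ha] using h a k
  · simpa only [if_neg ha] using h' a k

protected theorem sum_range {f : α → ℕ → ℝ} {N : α → ℕ} (hN : Computable N)
    (hf : ComputableReal fun x : α × ℕ => f x.1 x.2) :
    ComputableReal fun a => ∑ n ∈ Finset.range (N a), f a n := by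
  obtain ⟨q, C, hq, hC, h⟩ := hf
  have hq' : Computable fun x : (α × ℕ) × ℕ => q ((x.1.1, x.2), x.1.2) :=
    hq.comp (((Computable.fst.comp Computable.fst).pair Computable.snd).pair
      (Computable.snd.comp Computable.fst))
  refine ⟨fun x => ∑ n ∈ Finset.range (N x.1), q ((x.1, n), x.2),
    fun a => ∑ n ∈ Finset.range (N a), C (a, n),
    Computable.sum_range (hN.comp Computable.fst) (f := fun x n => q ((x.1, n), x.2)) hq',
    Computable.sum_range hN (f := fun a n => C (a, n)) hC, fun a k => ?_⟩
  push_cast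
  rw [Finset.sum_mul, ← Finset.sum_sub_distrib]
  exact (Finset.abs_sum_le_sum_abs _ _).trans (Finset.sum_le_sum fun n _ => h (a, n) k)

protected theorem sum_below {f : α → β → ℝ} {N : α → ℕ} (hN : Computable N)
    (hf : ComputableReal fun x : α × β => f x.1 x.2) :
    ComputableReal fun a => ∑ b ∈ below β (N a), f a b := by
  -- The sum runs over codes. `decode₂` succeeds at `n` only if `n` is the code of the result, so
  -- each element is counted once; all other `n` contribute `0`.
  have h : ComputableReal fun x : α × ℕ => ((Encodable.decode₂ β x.2).map (f x.1)).getD 0 := by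
    obtain ⟨q, C, hq, hC, h⟩ := hf
    refine ⟨fun x => ((Encodable.decode₂ β x.1.2).map fun b => q ((x.1.1, b), x.2)).getD 0,
      fun x => ((Encodable.decode₂ β x.2).map fun b => C (x.1, b)).getD 0, ?_, ?_, fun a k => ?_⟩
    · refine Computable.option_getD (Computable.option_map
        (Primrec.decode₂.to_comp.comp (Computable.snd.comp Computable.fst)) ?_) (Computable.const _)
      exact hq.comp (((Computable.fst.comp (Computable.fst.comp Computable.fst)).pair
        Computable.snd).pair (Computable.snd.comp Computable.fst))
    · refine Computable.option_getD (Computable.option_map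
        (Primrec.decode₂.to_comp.comp Computable.snd) ?_) (Computable.const _)
      exact hC.comp ((Computable.fst.comp Computable.fst).pair Computable.snd)
    · dsimp only
      generalize Encodable.decode₂ β a.2 = o
      cases o with
      | none => simp
      | some b => simpa using h (a.1, b) k
  have e : (fun a => ∑ b ∈ below β (N a), f a b) = fun a =>
      ∑ n ∈ Finset.range (N a), ((Encodable.decode₂ β n).map (f a)).getD 0 := by
    funext a
    rw [below, ← Finset.sum_preimage (Encodable.encode : β → ℕ) _ Encodable.encode_injective.injOn]
    · simp
    · intro n _ hn
      cases hd : Encodable.decode₂ β n with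
      | none => rfl
      | some b => exact absurd ⟨b, Encodable.mem_decode₂.1 hd⟩ hn
  rw [e]
  exact ComputableReal.sum_range hN (f := fun a n =>
    ((Encodable.decode₂ β n).map (f a)).getD 0) h

/-- The error in `f a` at precision `k` is at most `C a / 2 ^ k`, so a strict inequality is
certified as soon as `2 ^ k` times the gap exceeds `2 * C a`. -/
theorem re_lt {f : α → ℝ} {m d : α → ℕ} (hf : ComputableReal f) (hm : Computable m)
    (hd : Computable d) : REPred fun a => f a < m a / 2 ^ d a := by
  obtain ⟨q, C, hq, hC, h⟩ := hf
  refine rePred_iff_exists.2 ⟨fun a k => (q (a, k) + C a) * 2 ^ d a < m a * 2 ^ k, ?_, fun a => ?_⟩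
  · exact Primrec.nat_lt.computablePred.comp
      (Computable.pair (Primrec.nat_mul.to_comp.comp
        (Primrec.nat_add.to_comp.comp hq (hC.comp Computable.fst))
        (Primrec.two_pow.to_comp.comp (hd.comp Computable.fst)))
        (Primrec.nat_mul.to_comp.comp (hm.comp Computable.fst)
          (Primrec.two_pow.to_comp.comp Computable.snd)))
  · constructor
    · intro ha
      obtain ⟨k, hk⟩ := pow_unbounded_of_one_lt (2 * C a / (m a / 2 ^ d a - f a)) one_lt_two
      rw [div_lt_iff₀ (sub_pos.2 ha)] at hk
      refine ⟨k, ?_⟩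
      have h1 := abs_le.1 (h a k)
      have h2 : (q (a, k) + C a : ℝ) < m a / 2 ^ d a * 2 ^ k := by nlinarith
      have h3 : (q (a, k) + C a : ℝ) * 2 ^ d a < m a * 2 ^ k := by
        rw [div_mul_eq_mul_div, lt_div_iff₀ (by positivity)] at h2
        exact h2
      exact_mod_cast h3
    · rintro ⟨k, hk⟩
      have h1 := abs_le.1 (h a k)
      have h3 : (q (a, k) + C a : ℝ) * 2 ^ d a < m a * 2 ^ k := by exact_mod_cast hk
      rw [← lt_div_iff₀ (by positivity), mul_comm, mul_div_assoc, mul_comm] at h3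
      have h4 : f a * 2 ^ k < m a / 2 ^ d a * 2 ^ k := by linarith
      exact lt_of_mul_lt_mul_right h4 (by positivity)

theorem re_gt {f : α → ℝ} {m d : α → ℕ} (hf : ComputableReal f) (hm : Computable m)
    (hd : Computable d) : REPred fun a => m a / 2 ^ d a < f a := by
  obtain ⟨q, C, hq, hC, h⟩ := hf
  refine rePred_iff_exists.2 ⟨fun a k => m a * 2 ^ k + C a * 2 ^ d a < q (a, k) * 2 ^ d a, ?_,
    fun a => ?_⟩
  · exact Primrec.nat_lt.computablePred.comp
      (Computable.pair (Primrec.nat_add.to_comp.comp (Primrec.nat_mul.to_comp.comp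
        (hm.comp Computable.fst) (Primrec.two_pow.to_comp.comp Computable.snd))
        (Primrec.nat_mul.to_comp.comp (hC.comp Computable.fst)
          (Primrec.two_pow.to_comp.comp (hd.comp Computable.fst))))
        (Primrec.nat_mul.to_comp.comp hq
          (Primrec.two_pow.to_comp.comp (hd.comp Computable.fst))))
  · constructor
    · intro ha
      obtain ⟨k, hk⟩ := pow_unbounded_of_one_lt (2 * C a / (f a - m a / 2 ^ d a)) one_lt_two
      rw [div_lt_iff₀ (sub_pos.2 ha)] at hk
      refine ⟨k, ?_⟩
      have h1 := abs_le.1 (h a k)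
      have h2 : m a * 2 ^ k / 2 ^ d a < (q (a, k) - C a : ℝ) := by
        rw [mul_div_right_comm]
        nlinarith
      rw [div_lt_iff₀ (by positivity)] at h2
      have h3 : m a * 2 ^ k + C a * 2 ^ d a < (q (a, k) : ℝ) * 2 ^ d a := by linarith
      exact_mod_cast h3
    · rintro ⟨k, hk⟩
      have h1 := abs_le.1 (h a k)
      have h3 : m a * 2 ^ k + C a * 2 ^ d a < (q (a, k) : ℝ) * 2 ^ d a := by exact_mod_cast hk
      have h2 : m a * 2 ^ k / 2 ^ d a < (q (a, k) - C a : ℝ) := by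
        rw [div_lt_iff₀ (by positivity)]
        linarith
      rw [mul_div_right_comm] at h2
      have h4 : m a / 2 ^ d a * 2 ^ k < f a * 2 ^ k := by linarith
      exact lt_of_mul_lt_mul_right h4 (by positivity)

end ComputableReal

theorem IsComputableProb.computableReal {P : Measure (Omega × Omega)} (hP : IsComputableProb P) :
    ComputableReal fun x : S2 => (P (box x)).toReal := by
  obtain ⟨p, hp, h⟩ := hP
  have hp' : Computable fun x : S2 × ℕ => p (x.1, 2 ^ x.2) :=
    hp.comp (Computable.fst.pair (Primrec.two_pow.to_comp.comp Computable.snd))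
  -- The error bound `2` has two parts: at most `1` from the rational approximation at precision `2
  -- ^ k`, and at most `1` from rounding the quotient down.
  refine ⟨fun x => (p (x.1, 2 ^ x.2)).1 * 2 ^ x.2 / (p (x.1, 2 ^ x.2)).2, fun _ => 2,
    Primrec.nat_div.to_comp.comp (Primrec.nat_mul.to_comp.comp (Computable.fst.comp hp')
      (Primrec.two_pow.to_comp.comp Computable.snd)) (Computable.snd.comp hp'),
    Computable.const _, fun x k => ?_⟩
  have h1 := h x (2 ^ k) Nat.one_le_two_pow
  push_cast at h1 ⊢
  generalize (p (x, 2 ^ k)).1 = m at *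
  generalize (p (x, 2 ^ k)).2 = d at *
  have h2 : |(P (box x)).toReal * 2 ^ k - (m * 2 ^ k : ℝ) / d| ≤ 1 := by
    rw [mul_div_right_comm, ← sub_mul, abs_mul, abs_of_pos (a := (2 : ℝ) ^ k) (by positivity)]
    rw [lt_div_iff₀ (by positivity)] at h1
    exact h1.le
  have h3 : |(m * 2 ^ k : ℝ) / d - ((m * 2 ^ k / d : ℕ) : ℝ)| ≤ 1 := by
    have h4 := Nat.floor_div_eq_div (K := ℝ) (m * 2 ^ k) d
    push_cast at h4
    rw [← h4, abs_le]
    have h5 := Nat.floor_le (a := (m * 2 ^ k : ℝ) / d) (by positivity)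
    have h6 := Nat.lt_floor_add_one ((m * 2 ^ k : ℝ) / d)
    constructor <;> linarith
  calc _ ≤ _ := abs_sub_le _ ((m * 2 ^ k : ℝ) / d) _
    _ ≤ 2 := by linarith

end ProductKm

end Computability

/-! ### Dyadic intervals of binary words. -/

namespace ProductKm

theorem ofFin_le_ofFin {x y : S2} : ofFin x ≤ ofFin y ↔ x.1 <+: y.1 ∧ x.2 <+: y.2 := Iff.rfl

theorem box_anti {x y : S2} (h : ofFin x ≤ ofFin y) : box y ⊆ box x := fun _ hw => h.trans hw

theorem Comp2.of_le_ofFin {x y : S2} (h : ofFin x ≤ ofFin y) : Comp2 x y :=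
  Comp2.of_le h le_rfl

theorem Comp2.symm {x y : S2} (h : Comp2 x y) : Comp2 y x := ⟨h.1.symm, h.2.symm⟩

theorem Comp2.empty_left (x : S2) : Comp2 empty2 x := ⟨Or.inl List.nil_prefix, Or.inl List.nil_prefix⟩

/-- The number with binary expansion `p`. -/
def binVal (p : List Bool) : ℕ := p.foldl (fun v b => 2 * v + b.toNat) 0

theorem binVal_append_singleton (p : List Bool) (b : Bool) :
    binVal (p ++ [b]) = 2 * binVal p + b.toNat := by
  simp [binVal, List.foldl_append]

theorem binVal_primrec : Primrec binVal :=
  have h : Primrec₂ fun (_ : List Bool) (x : ℕ × Bool) => 2 * x.1 + x.2.toNat :=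
    Primrec.nat_add.comp (Primrec.nat_double.comp (Primrec.fst.comp Primrec.snd))
      ((Primrec.dom_bool Bool.toNat).comp (Primrec.snd.comp Primrec.snd))
  Primrec.list_foldl Primrec.id (Primrec.const 0) h

theorem binVal_append_bounds (p r : List Bool) :
    binVal p * 2 ^ r.length ≤ binVal (p ++ r) ∧
      binVal (p ++ r) + 1 ≤ (binVal p + 1) * 2 ^ r.length := by
  induction r using List.reverseRecOn with
  | nil => simp
  | append_singleton r b ih =>
    rw [← List.append_assoc, binVal_append_singleton, List.length_append, List.length_singleton,
      pow_succ]
    have : b.toNat ≤ 1 := by cases b <;> simp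
    constructor <;> nlinarith [ih.1, ih.2]

theorem exists_binVal (d m : ℕ) (h : m < 2 ^ d) : ∃ p : List Bool, p.length = d ∧ binVal p = m := by
  induction d generalizing m with
  | zero => exact ⟨[], rfl, by simp at h; simp [binVal, h]⟩
  | succ d ih =>
    obtain ⟨p, hp, hv⟩ := ih (m / 2) (by rw [pow_succ] at h; omega)
    refine ⟨p ++ [decide (m % 2 = 1)], by simp [hp], ?_⟩
    rw [binVal_append_singleton, hv]
    rcases Nat.mod_two_eq_zero_or_one m with h' | h' <;> simp [h'] <;> omega

/-- The endpoints of the dyadic interval of `p`. -/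
noncomputable def dyadicLo (p : List Bool) : ℝ := binVal p / 2 ^ p.length

noncomputable def dyadicHi (p : List Bool) : ℝ := (binVal p + 1) / 2 ^ p.length

theorem dyadicLo_lt_dyadicHi (p : List Bool) : dyadicLo p < dyadicHi p := by
  unfold dyadicLo dyadicHi
  gcongr
  linarith

theorem dyadic_of_prefix {p q : List Bool} (h : p <+: q) :
    dyadicLo p ≤ dyadicLo q ∧ dyadicHi q ≤ dyadicHi p := by
  obtain ⟨r, rfl⟩ := h
  unfold dyadicLo dyadicHi
  rw [List.length_append, pow_add]
  have h1 : (binVal p * 2 ^ r.length : ℝ) ≤ binVal (p ++ r) := by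
    exact_mod_cast (binVal_append_bounds p r).1
  have h2 : (binVal (p ++ r) + 1 : ℝ) ≤ (binVal p + 1) * 2 ^ r.length := by
    exact_mod_cast (binVal_append_bounds p r).2
  constructor
  · rw [div_le_div_iff₀ (by positivity) (by positivity)]
    nlinarith [pow_pos (two_pos (α := ℝ)) p.length]
  · rw [div_le_div_iff₀ (by positivity) (by positivity)]
    nlinarith [pow_pos (two_pos (α := ℝ)) p.length]

theorem exists_dyadic_between {a b : ℝ} {l : ℕ} (ha : 0 ≤ a) (hb : b ≤ 1)
    (h : (2⁻¹ : ℝ) ^ l < b - a) :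
    ∃ p : List Bool, p.length = l + 2 ∧ a < dyadicLo p ∧ dyadicHi p < b := by
  -- Scaled by `2 ^ (l + 2)`, the interval is longer than `4`, and `m + 1` exceeds its left end by
  -- at most `2`; both ends of the dyadic interval are thus strictly inside.
  set m := ⌊a * 2 ^ (l + 2)⌋₊ + 1 with hm
  have h1 : a * 2 ^ (l + 2) < m := by
    rw [hm]
    exact_mod_cast Nat.lt_floor_add_one (a * 2 ^ (l + 2))
  have h2 : (m : ℝ) ≤ a * 2 ^ (l + 2) + 1 := by
    rw [hm]
    push_cast
    linarith [Nat.floor_le (a := a * 2 ^ (l + 2)) (by positivity)]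
  have h3 : (1 : ℝ) < (b - a) * 2 ^ l := by
    calc (1 : ℝ) = (2⁻¹ : ℝ) ^ l * 2 ^ l := by rw [← mul_pow]; norm_num
      _ < _ := by gcongr
  have h4 : (m + 1 : ℝ) < b * 2 ^ (l + 2) := by
    rw [pow_add] at h2 ⊢
    nlinarith
  have h5 : m < 2 ^ (l + 2) := by
    have : (m : ℝ) < 2 ^ (l + 2) := by
      nlinarith [pow_pos (two_pos (α := ℝ)) (l + 2)]
    exact_mod_cast this
  obtain ⟨p, hp, hv⟩ := exists_binVal _ m h5
  refine ⟨p, hp, ?_, ?_⟩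
  · rw [dyadicLo, hv, hp, lt_div_iff₀ (by positivity)]
    exact h1
  · rw [dyadicHi, hv, hp, div_lt_iff₀ (by positivity)]
    exact h4

/-! ### Programs for the optimal function obtained from intervals. -/

section Optimal

variable {E : Set (ℕ × S2 × S2)}

theorem optimalRel_consistent (hE : IsUniversalEnumeration E) : Consistent (optimalRel E) := by
  rintro _ ⟨i, q, x, hx, rfl⟩ _ ⟨j, r, y, hy, rfl⟩ ⟨h1, h2⟩
  obtain ⟨rfl, h3⟩ := comp1_code h1
  exact ((monotoneCond_iff _).1 (hE.sound i)).2 (q, x) hx (r, y) hy ⟨h3, h2⟩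

/-- Optimality: `F` is a section of the enumeration, say the `i`-th, so `u` simulates it at the
fixed cost of the `i + 1` bits that encode `i`. -/
theorem optimalFun_dominates (hE : IsUniversalEnumeration E) {F : Set (S2 × S2)}
    (hF : REPred fun a : S2 × S2 => a ∈ F) (h0 : ∀ p, (p, empty2) ∈ F) (hc : Consistent F) :
    ∃ i : ℕ, ∀ p x : S2, (p, x) ∈ F →
      ofFin x ≤ optimalFun E (ofFin (List.replicate i false ++ true :: p.1, p.2)) := by
  obtain ⟨i, hi⟩ := hE.complete F hF ((monotoneCond_iff F).2 ⟨h0, hc⟩)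
  refine ⟨i, fun p x hx => (optimalFun_isLUB hE _).1 ⟨x, ⟨_, le_rfl, i, p, x, ?_, rfl⟩, rfl⟩⟩
  rw [← hi] at hx
  exact hx

theorem Km_le {u : Word2 → Word2} {x : Word2} {p : List Bool}
    (h : x ≤ u (ofFin (p, []))) : Km u x ≤ p.length :=
  sInf_le ⟨Word.fin p, h, rfl⟩

theorem Km2_le_Km (u : Word2 → Word2) (x : Word2) : Km2 u x ≤ Km u x := by
  refine le_sInf ?_
  rintro _ ⟨p, hp, rfl⟩
  exact sInf_le ⟨(p, Word.fin []), hp, by simp [Word.length]⟩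

/-- If the intervals `(lo a, hi a)` overlap only for compatible outputs, then `out a` has a program
of length about `-log (hi a - lo a)`. -/
theorem exists_Km_le_of_intervals {α : Type*} [Primcodable α] (hE : IsUniversalEnumeration E)
    {D : α → Prop} (hD : REPred D) {lo hi : α → ℝ} (hlo : ComputableReal lo)
    (hhi : ComputableReal hi) {out : α → S2} (hout : Computable out)
    (h0 : ∀ a, D a → 0 ≤ lo a) (h1 : ∀ a, D a → hi a ≤ 1)
    (hdisj : ∀ a b, D a → D b → lo a < hi b → lo b < hi a → Comp2 (out a) (out b)) :
    ∃ c : ℕ, ∀ a, D a → ∀ l : ℕ, (2⁻¹ : ℝ) ^ l < hi a - lo a →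
      Km (optimalFun E) (ofFin (out a)) ≤ ((l + c : ℕ) : ℕ∞) := by
  -- The condition is strict at both ends, which makes it enumerable from approximations of `lo` and
  -- `hi`.
  let F : Set (S2 × S2) := {y | y.2 = empty2 ∨ ∃ a, (D a ∧ y.2 = out a) ∧
    lo a < dyadicLo y.1.1 ∧ dyadicHi y.1.1 < hi a}
  have hF : REPred fun y : S2 × S2 => y ∈ F := by
    have hv : Computable fun y : (S2 × S2) × α => binVal y.1.1.1 :=
      binVal_primrec.to_comp.comp (Computable.fst.comp (Computable.fst.comp Computable.fst))
    have hl : Computable fun y : (S2 × S2) × α => y.1.1.1.length :=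
      Computable.list_length.comp (Computable.fst.comp (Computable.fst.comp Computable.fst))
    refine REPred.or (ComputablePred.to_re (Primrec.eq.computablePred.comp
      (Computable.snd.pair (Computable.const _)))) (REPred.ex (REPred.and (REPred.and ?_ ?_)
        (REPred.and ?_ ?_)))
    · exact hD.comp Computable.snd
    · exact (Primrec.eq.computablePred.comp ((Computable.snd.comp Computable.fst).pair
        (hout.comp Computable.snd))).to_re
    · exact (hlo.comp Computable.snd).re_lt hv hl
    · refine ((hhi.comp Computable.snd).re_gt (Computable.succ.comp hv) hl).of_eq fun y => ?_
      simp [dyadicHi]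
  obtain ⟨i, hi'⟩ := optimalFun_dominates hE hF (fun p => Or.inl rfl) (by
    rintro ⟨p, x⟩ hx ⟨q, y⟩ hy hpq
    rcases hx with hx | ⟨a, ⟨ha, hx⟩, ha1, ha2⟩
    · simp only at hx ⊢
      exact hx ▸ Comp2.empty_left _
    rcases hy with hy | ⟨b, ⟨hb, hy⟩, hb1, hb2⟩
    · simp only at hy ⊢
      exact hy ▸ (Comp2.empty_left _).symm
    simp only at hx hy ha1 ha2 hb1 hb2 ⊢
    subst hx hy
    -- Comparable words have nested dyadic intervals, so the intervals of `a` and `b` overlap and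
    -- `hdisj` applies.
    have hp := dyadicLo_lt_dyadicHi p.1
    have hq := dyadicLo_lt_dyadicHi q.1
    rcases hpq.1 with h | h
    · have := dyadic_of_prefix h
      exact hdisj a b ha hb (by linarith) (by linarith)
    · have := dyadic_of_prefix h
      exact hdisj a b ha hb (by linarith) (by linarith))
  -- The dyadic word has length `l + 2`, and the index of `F` costs `i + 1` more.
  refine ⟨i + 3, fun a ha l hl => ?_⟩
  obtain ⟨p, hp, hp1, hp2⟩ := exists_dyadic_between (h0 a ha) (h1 a ha) hl
  refine (Km_le (hi' (p, []) (out a) (Or.inr ⟨a, ⟨ha, rfl⟩, hp1, hp2⟩))).trans (le_of_eq ?_)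
  simp [hp]
  ring

end Optimal

end ProductKm

/-! ### Boxes, and decidability of quantification over prefixes. -/

namespace ProductKm

theorem box_nonempty (x : S2) : (box x).Nonempty := by
  refine ⟨(fun i => x.1.getD i false, fun i => x.2.getD i false), ?_, ?_⟩ <;>
  · intro i hi
    simp [List.getD_eq_getElem?_getD, List.getElem?_eq_getElem hi]

theorem not_disjoint_box {x y : S2} (h : ofFin x ≤ ofFin y) : ¬ Disjoint (box x) (box y) := by
  obtain ⟨w, hw⟩ := box_nonempty y
  exact Set.not_disjoint_iff.2 ⟨w, box_anti h hw, hw⟩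

theorem measurableSet_box (x : S2) : MeasurableSet (box x) := by
  have h1 : ∀ s : List Bool, MeasurableSet {w : Omega | Word.fin s ≤ Word.inf w} := by
    intro s
    have : {w : Omega | Word.fin s ≤ Word.inf w} = ⋂ i, ⋂ h : i < s.length, {w | w i = s[i]} := by
      ext w
      simp only [mem_ofPred_eq, mem_iInter]
      exact forall₂_congr fun i h => eq_comm
    rw [this]
    exact MeasurableSet.iInter fun i => MeasurableSet.iInter fun h =>
      (measurable_pi_apply i) (MeasurableSet.singleton _)
  exact (h1 x.1).prod (h1 x.2)

theorem exists_minimal_prefix {p : S2 → Prop} {x : S2} (h : p x) :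
    ∃ y, ofFin y ≤ ofFin x ∧ p y ∧ ∀ v, p v → ofFin v ≤ ofFin y → v = y := by
  obtain ⟨y, ⟨hy, hyx⟩, hmin⟩ := (measure fun z : S2 => z.1.length + z.2.length).wf.has_min
    {z | p z ∧ ofFin z ≤ ofFin x} ⟨x, h, le_rfl⟩
  refine ⟨y, hyx, hy, fun v hv hvy => ?_⟩
  have h1 := hmin v ⟨hv, hvy.trans hyx⟩
  have h2 := (ofFin_le_ofFin.1 hvy)
  simp only [WellFoundedRelation.rel, InvImage,
    not_lt] at h1
  have h3 := h2.1.length_le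
  have h4 := h2.2.length_le
  exact Prod.ext (h2.1.eq_of_length (by omega)) (h2.2.eq_of_length (by omega))

theorem sum_toReal_box (P : Measure (Omega × Omega)) [IsProbabilityMeasure P] (s : Finset S2)
    (hs : (s : Set S2).PairwiseDisjoint box) :
    ∑ x ∈ s, (P (box x)).toReal = (P (⋃ x ∈ s, box x)).toReal := by
  rw [measure_biUnion_finset hs fun x _ => measurableSet_box x,
    ENNReal.toReal_sum fun x _ => measure_ne_top _ _]

section Prefixes

variable {α : Type*} [Primcodable α]

theorem ofFin_le_iff_take {x y : S2} : ofFin x ≤ ofFin y ↔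
    ∃ i < y.1.length + 1, ∃ j < y.2.length + 1, (y.1.take i, y.2.take j) = x := by
  rw [ofFin_le_ofFin]
  constructor
  · rintro ⟨h1, h2⟩
    refine ⟨x.1.length, Nat.lt_succ_of_le h1.length_le, x.2.length, Nat.lt_succ_of_le h2.length_le,
      Prod.ext (List.prefix_iff_eq_take.1 h1).symm (List.prefix_iff_eq_take.1 h2).symm⟩
  · rintro ⟨i, -, j, -, rfl⟩
    exact ⟨List.take_prefix _ _, List.take_prefix _ _⟩

theorem computable_take {f : α → S2} (hf : Computable f) :
    Computable fun a : (α × ℕ) × ℕ => ((f a.1.1).1.take a.1.2, (f a.1.1).2.take a.2) := by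
  have hf' := hf.comp (Computable.fst.comp (Computable.fst (α := α × ℕ) (β := ℕ)))
  exact (Primrec.list_take.to_comp.comp (Computable.snd.comp Computable.fst)
    (Computable.fst.comp hf')).pair
    (Primrec.list_take.to_comp.comp Computable.snd (Computable.snd.comp hf'))

theorem computablePred_exists_prefix {p : α → S2 → Prop} {f : α → S2} (hf : Computable f)
    (hp : ComputablePred fun x : α × S2 => p x.1 x.2) :
    ComputablePred fun a => ∃ z, ofFin z ≤ ofFin (f a) ∧ p a z := by
  have h : ComputablePred fun a : α => ∃ i < (f a).1.length + 1, ∃ j < (f a).2.length + 1,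
      p a ((f a).1.take i, (f a).2.take j) := by
    refine ComputablePred.exists_lt (Computable.succ.comp (Computable.list_length.comp
      (Computable.fst.comp hf))) (ComputablePred.exists_lt (p := fun (x : α × ℕ) j =>
        p x.1 ((f x.1).1.take x.2, (f x.1).2.take j)) (N := fun x => (f x.1).2.length + 1)
          (Computable.succ.comp (Computable.list_length.comp
      (Computable.snd.comp (hf.comp Computable.fst)))) ?_)
    exact hp.comp ((Computable.fst.comp Computable.fst).pair (computable_take hf))
  refine h.of_eq fun a => ?_
  constructor
  · rintro ⟨i, hi, j, hj, h⟩
    exact ⟨_, ofFin_le_iff_take.2 ⟨i, hi, j, hj, rfl⟩, h⟩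
  · rintro ⟨z, hz, h⟩
    obtain ⟨i, hi, j, hj, rfl⟩ := ofFin_le_iff_take.1 hz
    exact ⟨i, hi, j, hj, h⟩

theorem computablePred_forall_prefix {p : α → S2 → Prop} {f : α → S2} (hf : Computable f)
    (hp : ComputablePred fun x : α × S2 => p x.1 x.2) :
    ComputablePred fun a => ∀ z, ofFin z ≤ ofFin (f a) → p a z :=
  (computablePred_exists_prefix (p := fun a z => ¬ p a z) hf hp.not).not.of_eq fun a => by
    push Not
    rfl

theorem computablePred_le : ComputablePred fun x : S2 × S2 => ofFin x.1 ≤ ofFin x.2 :=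
  (computablePred_exists_prefix (p := fun x z => z = x.1) Computable.snd
    (Primrec.eq.computablePred.comp (Computable.snd.pair
      (Computable.fst.comp Computable.fst)))).of_eq fun x => by simp

theorem computablePred_prefix : ComputablePred fun x : List Bool × List Bool => x.1 <+: x.2 :=
  (computablePred_le.comp (f := fun x : List Bool × List Bool => ((x.1, []), (x.2, [])))
    ((Computable.fst.pair (Computable.const _)).pair
      (Computable.snd.pair (Computable.const _)))).of_eq fun x => by simp [ofFin_le_ofFin]

/-- A bound on the codes of the prefixes of `x`. -/
def prefixCodeBound (x : S2) : ℕ :=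
  ∑ i ∈ Finset.range (x.1.length + 1), ∑ j ∈ Finset.range (x.2.length + 1),
    Encodable.encode ((x.1.take i, x.2.take j) : S2)

theorem encode_le_prefixCodeBound {x y : S2} (h : ofFin y ≤ ofFin x) :
    Encodable.encode y ≤ prefixCodeBound x := by
  obtain ⟨i, hi, j, hj, rfl⟩ := ofFin_le_iff_take.1 h
  refine le_trans ?_ (Finset.single_le_sum (fun _ _ => Nat.zero_le _) (Finset.mem_range.2 hi))
  exact Finset.single_le_sum (f := fun j => Encodable.encode ((x.1.take i, x.2.take j) : S2))
    (fun _ _ => Nat.zero_le _) (Finset.mem_range.2 hj)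

theorem computable_prefixCodeBound : Computable prefixCodeBound :=
  Computable.sum_range (N := fun x : S2 => x.1.length + 1)
    (Computable.succ.comp (Computable.list_length.comp Computable.fst))
    (Computable.sum_range (N := fun x : S2 × ℕ => x.1.2.length + 1)
      (f := fun (x : S2 × ℕ) j => Encodable.encode ((x.1.1.take x.2, x.1.2.take j) : S2))
      (Computable.succ.comp (Computable.list_length.comp
        (Computable.snd.comp Computable.fst)))
      (Computable.encode.comp (computable_take (f := id) Computable.id)))

end Prefixes

/-! ### The forest `A` and its left-to-right order. -/

/-- Every proper prefix of `x` in `A` is a proper prefix of `y`. -/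
def ProperPrefixesSubset (A : Set S2) (x y : S2) : Prop :=
  ∀ v, ofFin v ≤ ofFin x → v ∈ A ∧ v ≠ x → ofFin v ≤ ofFin y ∧ v ≠ y

/-- `u` lies to the left of `x` in the tree `A`, where siblings are ordered by their codes. -/
def LeftOf (A : Set S2) (x u : S2) : Prop :=
  u ∈ A ∧ ∃ z, ofFin z ≤ ofFin x ∧ (z ∈ A ∧ (ProperPrefixesSubset A u z ∧
    ProperPrefixesSubset A z u) ∧ Encodable.encode u < Encodable.encode z)

theorem computablePred_leftOf {A : Set S2} (hA : ComputablePred fun x : S2 => x ∈ A) :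
    ComputablePred fun x : S2 × S2 => LeftOf A x.1 x.2 := by
  have hne : ComputablePred fun x : S2 × S2 => x.1 ≠ x.2 := Primrec.eq.computablePred.not
  have hsub : ComputablePred fun x : S2 × S2 => ProperPrefixesSubset A x.1 x.2 := by
    refine computablePred_forall_prefix (p := fun (x : S2 × S2) v =>
      v ∈ A ∧ v ≠ x.1 → ofFin v ≤ ofFin x.2 ∧ v ≠ x.2) Computable.fst ?_
    have h1 := Computable.snd.pair (Computable.fst.comp (Computable.fst (α := S2 × S2) (β := S2)))
    have h2 := Computable.snd.pair (Computable.snd.comp (Computable.fst (α := S2 × S2) (β := S2)))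
    exact ((hA.comp Computable.snd).and (hne.comp h1)).imp
      ((computablePred_le.comp h2).and (hne.comp h2))
  refine (hA.comp Computable.snd).and (computablePred_exists_prefix Computable.fst ?_)
  have h1 := (Computable.snd.comp (Computable.fst (α := S2 × S2) (β := S2))).pair Computable.snd
  have h2 := Computable.snd.pair (Computable.snd.comp (Computable.fst (α := S2 × S2) (β := S2)))
  exact (hA.comp Computable.snd).and (((hsub.comp h1).and (hsub.comp h2)).and
    (Primrec.nat_lt.computablePred.comp ((Computable.encode.comp (Computable.fst.comp h1)).pair
      (Computable.encode.comp Computable.snd))))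

section Left

variable {A : Set S2} (hA1 : ComparableOrDisjoint A)
include hA1

/-- The sibling `z` of `u` below `x` differs from `u` and has the same proper prefixes in `A`. Were
one a prefix of the other, it would be a proper prefix of itself; hence their boxes are disjoint. -/
theorem LeftOf.disjoint {x u : S2} (h : LeftOf A x u) : Disjoint (box u) (box x) := by
  obtain ⟨hu, z, hzx, hz, ⟨h1, h2⟩, hlt⟩ := h
  have hne : u ≠ z := by rintro rfl; exact lt_irrefl _ hlt
  rcases hA1 u hu z hz with h | h | h
  · exact absurd rfl (h2 u h ⟨hu, hne⟩).2
  · exact absurd rfl (h1 z h ⟨hz, hne.symm⟩).2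
  · exact h.mono_right (box_anti hzx)

/-- A proper prefix `u` of `v` in `A` is also a proper prefix of the sibling of `v` below `x`, hence
a prefix of `x`, against `LeftOf.disjoint`. -/
theorem LeftOf.eq_of_le {x u v : S2} (hu : LeftOf A x u) (hv : LeftOf A x v)
    (h : ofFin u ≤ ofFin v) : u = v := by
  by_contra hne
  obtain ⟨_, z, hzx, -, ⟨h1, -⟩, -⟩ := hv
  exact not_disjoint_box ((h1 u h ⟨hu.1, hne⟩).1.trans hzx) (hu.disjoint hA1)

theorem LeftOf.pairwise_disjoint {x u v : S2} (hu : LeftOf A x u) (hv : LeftOf A x v)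
    (hne : u ≠ v) : Disjoint (box u) (box v) := by
  rcases hA1 u hu.1 v hv.1 with h | h | h
  · exact absurd (LeftOf.eq_of_le hA1 hu hv h) hne
  · exact absurd (LeftOf.eq_of_le hA1 hv hu h).symm hne
  · exact h

/-- Applied in both directions, this shows that the points where the branches to `x` and `y` part
are siblings. By minimality `v` lies below `y`, as does `y'`, so the two are comparable; `y'` below
`v` would put `y'` below `x`. -/
theorem properPrefixesSubset_of_minimal {x y x' y' : S2} (hy : y' ∈ A)
    (hx' : ofFin x' ≤ ofFin x) (hy' : ofFin y' ≤ ofFin y) (hyx : ¬ ofFin y' ≤ ofFin x)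
    (hmin : ∀ v, v ∈ A ∧ ¬ ofFin v ≤ ofFin y → ofFin v ≤ ofFin x' → v = x') :
    ProperPrefixesSubset A x' y' := by
  rintro v hv ⟨hvA, hne⟩
  have hvy : ofFin v ≤ ofFin y := by
    by_contra h
    exact hne (hmin v ⟨hvA, h⟩ hv)
  have hne' : v ≠ y' := by
    rintro rfl
    exact hyx (hv.trans hx')
  refine ⟨?_, hne'⟩
  rcases hA1 v hvA y' hy with h | h | h
  · exact h
  · exact absurd (h.trans (hv.trans hx')) hyx
  · obtain ⟨w, hw⟩ := box_nonempty y
    exact absurd h (Set.not_disjoint_iff.2 ⟨w, box_anti hvy hw, box_anti hy' hw⟩)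

/-- The branches to `x` and `y` separate at siblings `x'` and `y'`, and the smaller code decides
which element is further left. If it is `x'`, then `x'` is left of `y` and its box swallows whatever
hangs below `x'`; an element left of `x` by a branching at or before `x'` is left of `y` already. -/
theorem leftOf_total {x y : S2} (hx : x ∈ A) (hy : y ∈ A) (hxy : ¬ ofFin x ≤ ofFin y)
    (hyx : ¬ ofFin y ≤ ofFin x) :
    (∀ u, u = x ∨ LeftOf A x u → ∃ v, LeftOf A y v ∧ box u ⊆ box v) ∨
      (∀ u, u = y ∨ LeftOf A y u → ∃ v, LeftOf A x v ∧ box u ⊆ box v) := by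
  have key : ∀ {x y x' y' : S2}, x' ∈ A → y' ∈ A → ofFin x' ≤ ofFin x → ofFin y' ≤ ofFin y →
      ¬ ofFin x' ≤ ofFin y →
      (∀ v, v ∈ A ∧ ¬ ofFin v ≤ ofFin y → ofFin v ≤ ofFin x' → v = x') →
      ProperPrefixesSubset A x' y' → ProperPrefixesSubset A y' x' →
      Encodable.encode x' < Encodable.encode y' → x ∈ A →
      ∀ u, u = x ∨ LeftOf A x u → ∃ v, LeftOf A y v ∧ box u ⊆ box v := by
    intro x y x' y' hx'A hy'A hx' hy' hx'y hmin h1 h2 hlt hx u hu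
    have hL : LeftOf A y x' := ⟨hx'A, y', hy', hy'A, ⟨h1, h2⟩, hlt⟩
    rcases hu with rfl | hu
    · exact ⟨x', hL, box_anti hx'⟩
    · obtain ⟨huA, z, hzx, hzA, ⟨h3, h4⟩, hlt'⟩ := hu
      by_cases hzy : ofFin z ≤ ofFin y
      · exact ⟨u, ⟨huA, z, hzy, hzA, ⟨h3, h4⟩, hlt'⟩, le_rfl⟩
      by_cases hz : z = x'
      · subst hz
        refine ⟨u, ⟨huA, y', hy', hy'A, ⟨fun v hv hv' => ?_, fun v hv hv' => ?_⟩,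
          hlt'.trans hlt⟩, le_rfl⟩
        · have := h3 v hv hv'
          exact h1 v this.1 ⟨hv'.1, this.2⟩
        · have := h2 v hv hv'
          exact h4 v this.1 ⟨hv'.1, this.2⟩
      · have hx'z : ofFin x' ≤ ofFin z := by
          rcases hA1 x' hx'A z hzA with h | h | h
          · exact h
          · exact absurd (hmin z ⟨hzA, hzy⟩ h) hz
          · obtain ⟨w, hw⟩ := box_nonempty x
            exact absurd h (Set.not_disjoint_iff.2 ⟨w, box_anti hx' hw, box_anti hzx hw⟩)
        exact ⟨x', hL, box_anti (h4 x' hx'z ⟨hx'A, Ne.symm hz⟩).1⟩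
  obtain ⟨x', hx', ⟨hx'A, hx'y⟩, hminx⟩ := exists_minimal_prefix
    (p := fun v => v ∈ A ∧ ¬ ofFin v ≤ ofFin y) (x := x) ⟨hx, hxy⟩
  obtain ⟨y', hy', ⟨hy'A, hy'x⟩, hminy⟩ := exists_minimal_prefix
    (p := fun v => v ∈ A ∧ ¬ ofFin v ≤ ofFin x) (x := y) ⟨hy, hyx⟩
  have h1 := properPrefixesSubset_of_minimal hA1 hy'A hx' hy' hy'x hminx
  have h2 := properPrefixesSubset_of_minimal hA1 hx'A hy' hx' hx'y hminy
  rcases lt_trichotomy (Encodable.encode x') (Encodable.encode y') with h | h | h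
  · exact Or.inl (key hx'A hy'A hx' hy' hx'y hminx h1 h2 h hx)
  · exact absurd (Encodable.encode_injective h ▸ hx') hy'x
  · exact Or.inr (key hy'A hx'A hy' hx' hy'x hminy h2 h1 h hy)

end Left

open Classical in
/-- The elements of `A` to the left of `x`. -/
noncomputable def leftFinset (A : Set S2) (x : S2) : Finset S2 :=
  (below S2 (prefixCodeBound x)).filter fun u => LeftOf A x u

theorem mem_leftFinset {A : Set S2} {x u : S2} : u ∈ leftFinset A x ↔ LeftOf A x u := by
  simp only [leftFinset, Finset.mem_filter, mem_below, and_iff_right_iff_imp]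
  rintro ⟨_, z, hz, _, _, h⟩
  exact h.trans_le (encode_le_prefixCodeBound hz)

/-- The coding half of the comparison, uniform over `A`. The left end of the interval of `x` is the
measure of the union of the disjoint boxes left of `x`; by `leftOf_total`, of two incomparable
elements one has its whole interval before the other. -/
theorem exists_Km_le_neg_log {E : Set (ℕ × S2 × S2)} (hE : IsUniversalEnumeration E)
    {P : Measure (Omega × Omega)} [IsProbabilityMeasure P] (hP : IsComputableProb P)
    {A : Set S2} (hA : ComputablePred fun x : S2 => x ∈ A) (hA1 : ComparableOrDisjoint A) :
    ∃ c : ℕ, ∀ x ∈ A, ∀ l : ℕ, (2⁻¹ : ℝ) ^ l < (P (box x)).toReal →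
      Km (optimalFun E) (ofFin x) ≤ ((l + c : ℕ) : ℕ∞) := by
  classical
  have hlo : ComputableReal fun x => ∑ u ∈ leftFinset A x, (P (box u)).toReal := by
    simp only [leftFinset, Finset.sum_filter]
    exact ComputableReal.sum_below computable_prefixCodeBound
      (f := fun x u => if LeftOf A x u then (P (box u)).toReal else 0)
      (ComputableReal.ite (computablePred_leftOf hA) (hP.computableReal.comp Computable.snd)
        ComputableReal.zero)
  have hlo_eq : ∀ x, ∑ u ∈ leftFinset A x, (P (box u)).toReal =
      (P (⋃ u ∈ leftFinset A x, box u)).toReal := fun x => sum_toReal_box P _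
    fun u hu v hv hne => LeftOf.pairwise_disjoint hA1 (mem_leftFinset.1 hu) (mem_leftFinset.1 hv) hne
  have hhi_eq : ∀ x, ∑ u ∈ leftFinset A x, (P (box u)).toReal + (P (box x)).toReal =
      (P (⋃ u ∈ insert x (leftFinset A x), box u)).toReal := by
    intro x
    have hx : x ∉ leftFinset A x := fun h =>
      not_disjoint_box le_rfl ((mem_leftFinset.1 h).disjoint hA1)
    rw [add_comm, ← Finset.sum_insert (f := fun u => (P (box u)).toReal) hx]
    refine sum_toReal_box P _ ?_
    rw [Finset.coe_insert]
    refine Set.PairwiseDisjoint.insert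
      (fun u hu v hv hne => LeftOf.pairwise_disjoint hA1 (mem_leftFinset.1 hu)
        (mem_leftFinset.1 hv) hne) fun u hu _ => ((mem_leftFinset.1 hu).disjoint hA1).symm
  have hle : ∀ x y, (∀ u, u = x ∨ LeftOf A x u → ∃ v, LeftOf A y v ∧ box u ⊆ box v) →
      ∑ u ∈ leftFinset A x, (P (box u)).toReal + (P (box x)).toReal ≤
        ∑ u ∈ leftFinset A y, (P (box u)).toReal := by
    intro x y h
    rw [hhi_eq, hlo_eq]
    refine ENNReal.toReal_mono (measure_ne_top _ _) (measure_mono ?_)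
    refine Set.iUnion₂_subset fun u hu => ?_
    rw [Finset.mem_insert, mem_leftFinset] at hu
    obtain ⟨v, hv, huv⟩ := h u hu
    exact huv.trans (Set.subset_biUnion_of_mem (u := box) (mem_leftFinset.2 hv))
  obtain ⟨c, hc⟩ := exists_Km_le_of_intervals hE (D := fun x => x ∈ A) hA.to_re hlo
    (hlo.add hP.computableReal) Computable.id
    (fun x _ => Finset.sum_nonneg fun _ _ => ENNReal.toReal_nonneg)
    (fun x _ => by
      rw [hhi_eq]
      exact ENNReal.toReal_le_of_le_ofReal zero_le_one (by simpa using prob_le_one))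
    (fun x y hx hy h1 h2 => by
      by_contra hne
      rcases leftOf_total hA1 hx hy (fun h => hne (Comp2.of_le_ofFin h))
        (fun h => hne (Comp2.of_le_ofFin h).symm) with h | h
      · exact absurd h2 (not_lt.2 (hle x y h))
      · exact absurd h1 (not_lt.2 (hle y x h)))
  exact ⟨c, fun x hx l hl => hc x hx l (by simpa using hl)⟩

end ProductKm

/-! ### Enumerability and monotonicity of the optimal function; the uniform measure. -/

namespace ProductKm

theorem Comp2.not_disjoint_box {x y : S2} (h : Comp2 x y) : ¬ Disjoint (box x) (box y) := by
  obtain ⟨r, h1, h1'⟩ := h.1.exists_join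
  obtain ⟨s, h2, h2'⟩ := h.2.exists_join
  obtain ⟨w, hw⟩ := box_nonempty (r, s)
  exact Set.not_disjoint_iff.2 ⟨w, box_anti (x := x) (y := (r, s)) ⟨h1, h2⟩ hw,
    box_anti (x := y) (y := (r, s)) ⟨h1', h2'⟩ hw⟩

theorem comp2_of_not_disjoint_box {x y : S2} (h : ¬ Disjoint (box x) (box y)) : Comp2 x y := by
  obtain ⟨w, h1, h2⟩ := Set.not_disjoint_iff.1 h
  exact Comp2.of_le h1 h2

section LUB

/-- If no element of `B` extends `s`, then `s` without its last letter is still an upper bound of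
`B`, contradicting that `s` lies below the least one. -/
theorem exists_prefix_of_le_lub {B : Set (List Bool)} {z : Word} (hz : IsLUB (Word.fin '' B) z)
    {s : List Bool} (hs : Word.fin s ≤ z) : s = [] ∨ ∃ t ∈ B, s <+: t := by
  by_contra! h
  obtain ⟨hne, h⟩ := h
  have hub : Word.fin s.dropLast ∈ upperBounds (Word.fin '' B) := by
    rintro _ ⟨t, ht, rfl⟩
    rcases Comp1.of_le hs (hz.1 ⟨t, ht, rfl⟩) with h1 | h1
    · exact absurd h1 (h t ht)
    · rw [← List.dropLast_append_getLast hne, List.prefix_concat_iff] at h1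
      rcases h1 with h1 | h1
      · rw [List.dropLast_append_getLast hne] at h1
        exact absurd (h1 ▸ List.prefix_rfl) (h t ht)
      · exact h1
  have h1 : s <+: s.dropLast := hs.trans (hz.2 hub)
  have h2 := h1.length_le
  have h3 := List.length_pos_iff.2 hne
  rw [List.length_dropLast] at h2
  omega

/-- This removes the join in favour of existential quantifiers, as needed to enumerate `x ⊑ u(p)`.
The two components may be witnessed by different elements of `B`. -/
theorem le_lub_iff {B : Set S2} {z : Word2} (hz : IsLUB (ofFin '' B) z) {x : S2} :
    ofFin x ≤ z ↔ (x.1 = [] ∨ ∃ y ∈ B, x.1 <+: y.1) ∧ (x.2 = [] ∨ ∃ y ∈ B, x.2 <+: y.2) := by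
  have hz' := isLUB_prod.1 hz
  have e1 : Prod.fst '' (ofFin '' B) = Word.fin '' (Prod.fst '' B) := by
    rw [image_image, image_image]; rfl
  have e2 : Prod.snd '' (ofFin '' B) = Word.fin '' (Prod.snd '' B) := by
    rw [image_image, image_image]; rfl
  rw [e1, e2] at hz'
  constructor
  · intro h
    constructor
    · exact (exists_prefix_of_le_lub hz'.1 h.1).imp id fun ⟨t, ⟨y, hy, e⟩, ht⟩ => ⟨y, hy, e ▸ ht⟩
    · exact (exists_prefix_of_le_lub hz'.2 h.2).imp id fun ⟨t, ⟨y, hy, e⟩, ht⟩ => ⟨y, hy, e ▸ ht⟩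
  · rintro ⟨h1, h2⟩
    have hnil : ∀ z : Word, Word.fin [] ≤ z := fun z => (Word.le_iff _ _).2 (by simp [Word.letter])
    constructor
    · rcases h1 with h | ⟨y, hy, h⟩
      · change Word.fin x.1 ≤ z.1
        rw [h]
        exact hnil _
      · exact le_trans ((Word.fin_le_fin _ _).2 h) (hz.1 ⟨y, hy, rfl⟩).1
    · rcases h2 with h | ⟨y, hy, h⟩
      · change Word.fin x.2 ≤ z.2
        rw [h]
        exact hnil _
      · exact le_trans ((Word.fin_le_fin _ _).2 h) (hz.1 ⟨y, hy, rfl⟩).2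

end LUB

section Optimal

variable {E : Set (ℕ × S2 × S2)} (hE : IsUniversalEnumeration E)
include hE

theorem optimalFun_mono : Monotone (optimalFun E) := fun p q hpq =>
  isLUB_le_iff (optimalFun_isLUB hE p) |>.2 fun _ ⟨x, ⟨p', hp', hx⟩, e⟩ =>
    (optimalFun_isLUB hE q).1 ⟨x, ⟨p', hp'.trans hpq, hx⟩, e⟩

/-- Programs whose boxes meet have a common extension, at which `u` lies above both outputs; this is
the Kraft-type property behind the lower bound. -/
theorem disjoint_programs {x y p q : S2} (hx : ofFin x ≤ optimalFun E (ofFin p))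
    (hy : ofFin y ≤ optimalFun E (ofFin q)) (h : Disjoint (box x) (box y)) :
    Disjoint (box p) (box q) := by
  by_contra hpq
  have hc := comp2_of_not_disjoint_box hpq
  obtain ⟨r, h1, h1'⟩ := hc.1.exists_join
  obtain ⟨s, h2, h2'⟩ := hc.2.exists_join
  have h3 : ofFin p ≤ ofFin (r, s) := ⟨h1, h2⟩
  have h4 : ofFin q ≤ ofFin (r, s) := ⟨h1', h2'⟩
  exact (Comp2.of_le (hx.trans (optimalFun_mono hE h3))
    (hy.trans (optimalFun_mono hE h4))).not_disjoint_box h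

theorem rePred_optimalRel : REPred fun a : S2 × S2 => a ∈ optimalRel E := by
  have hr : Primrec fun i : ℕ => List.replicate i false :=
    (Primrec.list_map Primrec.list_range (Primrec.const false).to₂).of_eq fun i => by simp
  refine REPred.ex (REPred.ex (REPred.ex (REPred.and ?_ (ComputablePred.to_re ?_))))
  · exact hE.re.comp (((Computable.snd.comp (Computable.fst.comp Computable.fst))).pair
      ((Computable.snd.comp Computable.fst).pair Computable.snd))
  · have hi : Computable fun a : (((S2 × S2) × ℕ) × S2) × S2 => a.1.1.2 :=
      Computable.snd.comp (Computable.fst.comp Computable.fst)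
    have hp : Computable fun a : (((S2 × S2) × ℕ) × S2) × S2 => a.1.2 :=
      Computable.snd.comp Computable.fst
    refine Primrec.eq.computablePred.comp ((Computable.fst.comp (Computable.fst.comp
      Computable.fst)).pair (Computable.pair (Computable.pair ?_ (Computable.snd.comp hp))
        Computable.snd))
    exact Computable.list_append.comp (hr.to_comp.comp hi)
      (Computable.list_cons.comp (Computable.const true) (Computable.fst.comp hp))

theorem rePred_le_optimalFun :
    REPred fun a : S2 × S2 => ofFin a.1 ≤ optimalFun E (ofFin a.2) := by
  have hout : REPred fun a : (S2 × S2) × S2 => a.2 ∈ outputs (optimalRel E) (ofFin a.1.2) :=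
    REPred.ex (REPred.and (computablePred_le.comp (Computable.snd.pair
      (Computable.snd.comp (Computable.fst.comp Computable.fst)))).to_re
      ((rePred_optimalRel hE).comp (Computable.snd.pair
        (Computable.snd.comp Computable.fst))))
  refine REPred.of_eq ?_ fun a => (le_lub_iff (optimalFun_isLUB hE (ofFin a.2))).symm
  refine REPred.and (REPred.or ?_ (REPred.ex (REPred.and hout ?_)))
    (REPred.or ?_ (REPred.ex (REPred.and hout ?_)))
  · exact (Primrec.eq.computablePred.comp ((Computable.fst.comp Computable.fst).pair
      (Computable.const []))).to_re
  · exact (computablePred_prefix.comp ((Computable.fst.comp (Computable.fst.comp Computable.fst)).pair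
      (Computable.fst.comp Computable.snd))).to_re
  · exact (Primrec.eq.computablePred.comp ((Computable.snd.comp Computable.fst).pair
      (Computable.const []))).to_re
  · exact (computablePred_prefix.comp ((Computable.snd.comp (Computable.fst.comp Computable.fst)).pair
      (Computable.snd.comp Computable.snd))).to_re

end Optimal

/-- The uniform measure on pairs of sequences. -/
theorem exists_uniform_measure : ∃ ν : Measure (Omega × Omega), IsProbabilityMeasure ν ∧
    ∀ p : S2, ν (box p) = (2⁻¹ : ℝ≥0∞) ^ (p.1.length + p.2.length) := by
  let μ : Measure Bool := (PMF.uniformOfFintype Bool).toMeasure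
  have hμ : ∀ b, μ {b} = 2⁻¹ := fun b => by
    simp [μ]
  let ν := Measure.infinitePi fun _ : ℕ => μ
  have h1 : ∀ s : List Bool, ν {w : Omega | Word.fin s ≤ Word.inf w} = 2⁻¹ ^ s.length := by
    intro s
    have : {w : Omega | Word.fin s ≤ Word.inf w} =
        Set.pi (Finset.range s.length : Finset ℕ) fun i => {s.getD i false} := by
      ext w
      simp only [mem_ofPred_eq, Set.mem_pi, Finset.coe_range, Set.mem_Iio, mem_singleton_iff]
      refine forall₂_congr fun i h => ?_
      rw [List.getD_eq_getElem?_getD, List.getElem?_eq_getElem h]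
      exact eq_comm
    rw [this, Measure.infinitePi_pi _ fun i _ => MeasurableSet.singleton _]
    simp [hμ]
  refine ⟨ν.prod ν, inferInstance, fun p => ?_⟩
  have : box p = {w : Omega | Word.fin p.1 ≤ Word.inf w} ×ˢ
      {w : Omega | Word.fin p.2 ≤ Word.inf w} := rfl
  rw [this, Measure.prod_prod, h1, h1, pow_add]

theorem pairwiseDisjoint_minimal {A B : Set S2} (hA1 : ComparableOrDisjoint A) (hB : B ⊆ A) :
    {x | x ∈ B ∧ ∀ v, v ∈ B → ofFin v ≤ ofFin x → v = x}.PairwiseDisjoint box := by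
  rintro x ⟨hx, hx'⟩ y ⟨hy, hy'⟩ hne
  rcases hA1 x (hB hx) y (hB hy) with h | h | h
  · exact absurd (hy' x hx h) hne
  · exact absurd (hx' y hy h).symm hne
  · exact h

theorem cover_eq_cover_minimal (B : Set S2) :
    cover B = ⋃ x ∈ {x | x ∈ B ∧ ∀ v, v ∈ B → ofFin v ≤ ofFin x → v = x}, box x := by
  refine Subset.antisymm (iUnion₂_subset fun x hx => ?_)
    (biUnion_mono (fun x hx => hx.1) fun _ _ => le_rfl)
  obtain ⟨y, hyx, hy, hmin⟩ := exists_minimal_prefix (p := fun v => v ∈ B) hx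
  exact (box_anti hyx).trans (subset_biUnion_of_mem (u := box) ⟨hy, hmin⟩)

/-! ### The test formed by outputs with too short programs. -/

section Deficient

variable {E : Set (ℕ × S2 × S2)} (hE : IsUniversalEnumeration E)
  {P : Measure (Omega × Omega)} [IsProbabilityMeasure P]
  {A : Set S2}

variable (E P A) in
/-- The elements of `A` with a program that is shorter than their measure allows. -/
def deficient : Set (ℕ × S2) := {a | a.2 ∈ A ∧ ∃ p : S2, ofFin a.2 ≤ optimalFun E (ofFin p) ∧
  (P (box a.2)).toReal < (2⁻¹ : ℝ) ^ (p.1.length + p.2.length + (a.1 + 1))}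

include hE

omit [IsProbabilityMeasure P] in
theorem rePred_deficient (hP : IsComputableProb P) (hA : ComputablePred fun x : S2 => x ∈ A) :
    REPred fun a : ℕ × S2 => a ∈ deficient E P A := by
  have hd : Computable fun a : (ℕ × S2) × S2 => a.2.1.length + a.2.2.length + (a.1.1 + 1) :=
    Primrec.nat_add.to_comp.comp (Primrec.nat_add.to_comp.comp
      (Computable.list_length.comp (Computable.fst.comp Computable.snd))
      (Computable.list_length.comp (Computable.snd.comp Computable.snd)))
      (Computable.succ.comp (Computable.fst.comp Computable.fst))
  have h1 : REPred fun a : (ℕ × S2) × S2 => ofFin a.1.2 ≤ optimalFun E (ofFin a.2) :=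
    (rePred_le_optimalFun hE).comp (f := fun a : (ℕ × S2) × S2 => (a.1.2, a.2))
      ((Computable.snd.comp Computable.fst).pair Computable.snd)
  have h2 : REPred fun a : (ℕ × S2) × S2 =>
      (P (box a.1.2)).toReal < (2⁻¹ : ℝ) ^ (a.2.1.length + a.2.2.length + (a.1.1 + 1)) := by
    have h3 : ComputableReal fun a : (ℕ × S2) × S2 => (P (box a.1.2)).toReal :=
      hP.computableReal.comp (Computable.snd.comp Computable.fst)
    refine (h3.re_lt (m := fun _ => 1) (Computable.const 1) hd).of_eq fun a => ?_
    rw [Nat.cast_one, one_div, inv_pow]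
  exact (hA.comp Computable.snd).to_re.and (REPred.ex (p := fun (a : ℕ × S2) (p : S2) =>
    ofFin a.2 ≤ optimalFun E (ofFin p) ∧
      (P (box a.2)).toReal < (2⁻¹ : ℝ) ^ (p.1.length + p.2.length + (a.1 + 1))) (h1.and h2))

/-- The minimal deficient elements cover the same set and have disjoint boxes. The chosen programs
then have disjoint boxes as well, of total uniform measure at most `1`, and each `P`-measure is at
most `2 ^ -(n + 1)` times that of the program. The spare factor `1/2` gives the strict inequality.
-/
theorem measure_cover_deficient (hA1 : ComparableOrDisjoint A) (n : ℕ) :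
    P (cover (level (deficient E P A) n)) < 2⁻¹ ^ n := by
  rw [cover_eq_cover_minimal]
  let M : Set S2 := {x | x ∈ level (deficient E P A) n ∧
    ∀ v, v ∈ level (deficient E P A) n → ofFin v ≤ ofFin x → v = x}
  have hdisj : M.PairwiseDisjoint box := pairwiseDisjoint_minimal hA1 fun x hx => hx.1
  obtain ⟨ν, hν, hνb⟩ := exists_uniform_measure
  have hex : ∀ x : M, ∃ p : S2, ofFin (x : S2) ≤ optimalFun E (ofFin p) ∧
      P (box x) ≤ ν (box p) * 2⁻¹ ^ (n + 1) := by
    rintro ⟨x, ⟨-, p, hp, hlt⟩, -⟩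
    refine ⟨p, hp, ?_⟩
    rw [hνb, ← pow_add]
    refine ((ENNReal.toReal_lt_toReal (measure_ne_top _ _) (by finiteness)).1 ?_).le
    rw [ENNReal.toReal_pow, ENNReal.toReal_inv, ENNReal.toReal_ofNat]
    exact hlt
  choose p hp hle using hex
  have hpd : Pairwise (Function.onFun Disjoint fun x : M => box (p x)) := fun x y hne =>
    disjoint_programs hE (hp x) (hp y) (hdisj x.2 y.2 fun h => hne (Subtype.ext h))
  calc P (⋃ x ∈ M, box x) ≤ ∑' x : M, P (box x) := measure_biUnion_le P (Set.to_countable M) _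
    _ ≤ ∑' x : M, ν (box (p x)) * 2⁻¹ ^ (n + 1) := ENNReal.tsum_le_tsum hle
    _ = ν (⋃ x : M, box (p x)) * 2⁻¹ ^ (n + 1) := by
      rw [ENNReal.tsum_mul_right, measure_iUnion hpd fun x => measurableSet_box _]
    _ ≤ 1 * 2⁻¹ ^ (n + 1) := by gcongr; exact prob_le_one
    _ < 2⁻¹ ^ n := by
      rw [one_mul, pow_succ, ← div_eq_mul_inv]
      exact ENNReal.half_lt_self (by simp) (by finiteness)

/-- Along a random pair, `P` is bounded below by a multiple of `2 ^ -Km²`. -/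
theorem exists_le_of_random (hP : IsComputableProb P)
    (hA : ComputablePred fun x : S2 => x ∈ A) (hA1 : ComparableOrDisjoint A)
    {w : Omega × Omega} (hw : w ∈ randomSet P) :
    ∃ n : ℕ, ∀ x ∈ prefixesIn A w, ∀ p : S2, ofFin x ≤ optimalFun E (ofFin p) →
      (2⁻¹ : ℝ) ^ (p.1.length + p.2.length + n) ≤ (P (box x)).toReal := by
  have h := hw (deficient E P A) ⟨rePred_deficient hE hP hA, fun n _ => ?_,
    fun n _ => measure_cover_deficient hE hA1 n⟩
  · simp only [testLimit, mem_iInter, not_forall] at h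
    obtain ⟨n, -, h⟩ := h
    refine ⟨n + 1, fun x hx p hp => not_lt.1 fun hlt => h ?_⟩
    exact mem_iUnion₂.2 ⟨x, ⟨hx.1, p, hp, hlt⟩, hx.2⟩
  · refine biUnion_mono ?_ fun _ _ => le_rfl
    rintro x ⟨hx, p, hp, hlt⟩
    exact ⟨hx, p, hp, hlt.trans_le
      (pow_le_pow_of_le_one (by norm_num) (by norm_num) (by simp))⟩

end Deficient

/-- A null box, repeated at every level, is a test that captures all of its points. -/
theorem pos_of_random {P : Measure (Omega × Omega)} {w : Omega × Omega} (hw : w ∈ randomSet P)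
    {x : S2} (hx : ofFin x ≤ ofInf w) : 0 < P (box x) := by
  by_contra h0
  have h0 : P (box x) = 0 := by simpa using h0
  have hc : ∀ n, cover (level {a : ℕ × S2 | a.2 = x} n) = box x := fun n => by
    simp [cover, level]
  refine hw {a | a.2 = x} ⟨?_, fun n _ => ?_, fun n _ => ?_⟩ ?_
  · exact (Primrec.eq.computablePred.comp (Computable.snd.pair (Computable.const x))).to_re
  · rw [hc, hc]
  · rw [hc, h0]
    exact ENNReal.pow_pos (by simp) n
  · simp only [testLimit, mem_iInter, hc]
    exact fun _ _ => hx

end ProductKm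

/-! ### The converse: short programs along a point that fails a test. -/

namespace ProductKm

/-- The join hypothesis yields one element of `A(w)` long enough in the first component and one
extending `y` in the second. Both lie below `w`, so they are comparable, and the larger serves. The
length bound is needed because `|x₁|` is the clock in `Listed`. -/
theorem exists_mem_prefixesIn_of_join {A : Set S2} (hA1 : ComparableOrDisjoint A)
    {w : Omega × Omega} (hj : IsJoinOfPrefixes A w) {y : S2} (hy : ofFin y ≤ ofInf w) (m : ℕ) :
    ∃ x ∈ prefixesIn A w, ofFin y ≤ ofFin x ∧ m < x.1.length := by
  set k := max y.1.length (m + 1) with hk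
  let s : List Bool := List.ofFn fun i : Fin k => w.1 i
  have hs : Word.fin s ≤ Word.inf w.1 := by
    intro i hi
    simp [s]
  have hsl : s.length = k := List.length_ofFn
  have hys : y.1 <+: s := by
    rcases Comp1.of_le hy.1 hs with h | h
    · exact h
    · rw [h.eq_of_length (le_antisymm h.length_le (by rw [hsl]; exact le_max_left _ _))]
  obtain ⟨h1, h2⟩ := (le_lub_iff hj (x := (s, y.2))).1 ⟨hs, hy.2⟩
  obtain ⟨x, hx, hsx⟩ : ∃ x ∈ prefixesIn A w, s <+: x.1 := by
    refine h1.resolve_left fun h => ?_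
    simp only at h
    rw [h, List.length_nil] at hsl
    omega
  have hlen : m < x.1.length := by
    have := hsx.length_le
    omega
  rcases h2 with h2 | ⟨x', hx', hyx'⟩
  · simp only at h2
    exact ⟨x, hx, ofFin_le_ofFin.2 ⟨hys.trans hsx, by rw [h2]; exact List.nil_prefix⟩, hlen⟩
  · rcases hA1 x hx.1 x' hx'.1 with h | h | h
    · exact ⟨x', hx', ⟨(hys.trans hsx).trans h.1, hyx'⟩,
        hlen.trans_le (ofFin_le_ofFin.1 h).1.length_le⟩
    · exact ⟨x, hx, ⟨hys.trans hsx, hyx'.trans h.2⟩, hlen⟩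
    · exact absurd h (Set.not_disjoint_iff.2 ⟨w, hx.2, hx'.2⟩)

section Converse

variable (R : ℕ × S2 → ℕ → Prop) (A : Set S2)

/-- The elements of `A` with a prefix that is listed at level `n` before stage `|x₁|`. -/
def Listed (n : ℕ) (x : S2) : Prop :=
  x ∈ A ∧ ∃ y, ofFin y ≤ ofFin x ∧ ∃ m < x.1.length, R (n, y) m

/-- The minimal elements of `A` listed at level `2 * (n + 1)`. -/
def MinListed (a : ℕ × S2) : Prop :=
  Listed R A (2 * (a.1 + 1)) a.2 ∧
    ∀ v, ofFin v ≤ ofFin a.2 → Listed R A (2 * (a.1 + 1)) v → v = a.2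

variable {R A}

/-- Bounding the stage by `|x₁|` leaves only finitely many prefixes and stages to inspect.
Decidability here is what makes the interval lengths computable reals. -/
theorem computablePred_minListed (hR : ComputablePred fun x : (ℕ × S2) × ℕ => R x.1 x.2)
    (hA : ComputablePred fun x : S2 => x ∈ A) : ComputablePred (MinListed R A) := by
  have h1 : ComputablePred fun a : ℕ × S2 => Listed R A a.1 a.2 := by
    refine (hA.comp Computable.snd).and (computablePred_exists_prefix
      (p := fun (a : ℕ × S2) y => ∃ m < a.2.1.length, R (a.1, y) m) Computable.snd ?_)
    refine ComputablePred.exists_lt (p := fun (b : (ℕ × S2) × S2) m => R (b.1.1, b.2) m)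
      (N := fun b => b.1.2.1.length) (Computable.list_length.comp (Computable.fst.comp
        (Computable.snd.comp Computable.fst))) ?_
    exact hR.comp (f := fun b : ((ℕ × S2) × S2) × ℕ => ((b.1.1.1, b.1.2), b.2))
      (((Computable.fst.comp (Computable.fst.comp Computable.fst)).pair
        (Computable.snd.comp Computable.fst)).pair Computable.snd)
  have hl : Computable fun a : ℕ × S2 => 2 * (a.1 + 1) :=
    Primrec.nat_double.to_comp.comp (Computable.succ.comp Computable.fst)
  refine (h1.comp (f := fun a : ℕ × S2 => (2 * (a.1 + 1), a.2)) (hl.pair Computable.snd)).and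
    (computablePred_forall_prefix (p := fun (a : ℕ × S2) v => Listed R A (2 * (a.1 + 1)) v → v = a.2)
      Computable.snd (ComputablePred.imp ?_ ?_))
  · exact h1.comp (f := fun b : (ℕ × S2) × S2 => (2 * (b.1.1 + 1), b.2))
      ((hl.comp Computable.fst).pair Computable.snd)
  · exact Primrec.eq.computablePred.comp (f := fun b : (ℕ × S2) × S2 => (b.2, b.1.2))
      (Computable.snd.pair (Computable.snd.comp Computable.fst))

variable {P : Measure (Omega × Omega)} [IsProbabilityMeasure P]

open Classical in
-- At fixed `n` the boxes are disjoint and lie in level `2 * (n + 1)` of the test, so the weights `2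
-- ^ n * P` add up to at most `2 ^ n * 2 ^ -(2 * (n + 1)) = 2 ^ -(n + 2)`; summing over `n` stays
-- below `1`.
theorem sum_minListed_le (hA1 : ComparableOrDisjoint A) {U : Set (ℕ × S2)} (hU : IsTest P U)
    (hRU : ∀ a m, R a m → a ∈ U) (s : Finset (ℕ × S2)) :
    ∑ a ∈ s, (if MinListed R A a then ((2 ^ a.1 : ℕ) : ℝ) * (P (box a.2)).toReal else 0) ≤ 1 := by
  let g : ℕ × S2 → ℝ≥0∞ := fun a => if MinListed R A a then 2 ^ a.1 * P (box a.2) else 0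
  have hg : ∀ a, (g a).toReal =
      if MinListed R A a then ((2 ^ a.1 : ℕ) : ℝ) * (P (box a.2)).toReal else 0 := by
    intro a
    by_cases h : MinListed R A a <;> simp [g, h]
  have hg' : ∀ a, g a ≠ ∞ := fun a => by
    by_cases h : MinListed R A a
    · simp only [g, if_pos h]
      finiteness
    · simp [g, h]
  have hn : ∀ n : ℕ, ∑' x : S2, g (n, x) ≤ 2⁻¹ ^ (n + 1) := by
    intro n
    let M : Set S2 := {x | MinListed R A (n, x)}
    have hdisj : M.PairwiseDisjoint box :=
      (pairwiseDisjoint_minimal (B := {x | Listed R A (2 * (n + 1)) x}) hA1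
        fun x hx => hx.1).subset fun x hx => ⟨hx.1, fun v hv hvx => hx.2 v hvx hv⟩
    have hsub : ⋃ x ∈ M, box x ⊆ cover (level U (2 * (n + 1))) := by
      refine iUnion₂_subset fun x hx => ?_
      obtain ⟨⟨-, y, hy, m, -, hm⟩, -⟩ := hx
      exact (box_anti hy).trans (subset_biUnion_of_mem (u := box) (hRU _ m hm))
    calc ∑' x : S2, g (n, x) = ∑' x : S2, M.indicator (fun x => 2 ^ n * P (box x)) x := by
          refine tsum_congr fun x => ?_
          simp only [g, Set.indicator_apply]
          rfl
      _ = 2 ^ n * P (⋃ x ∈ M, box x) := by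
          rw [← tsum_subtype, ENNReal.tsum_mul_left,
            measure_biUnion (Set.to_countable M) hdisj fun x _ => measurableSet_box x]
      _ ≤ 2 ^ n * 2⁻¹ ^ (2 * (n + 1)) := by
          gcongr
          exact (measure_mono hsub).trans (hU.small _ (by omega)).le
      _ = 2⁻¹ ^ (n + 2) := by
          rw [show 2 * (n + 1) = n + (n + 2) by ring, pow_add, ← mul_assoc, ← mul_pow,
            ENNReal.mul_inv_cancel (by simp) (by simp), one_pow, one_mul]
      _ ≤ 2⁻¹ ^ (n + 1) := pow_le_pow_of_le_one (by simp) (by simp) (by omega)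
  have htot : ∑ a ∈ s, g a ≤ 1 := by
    refine (ENNReal.sum_le_tsum s).trans ?_
    rw [ENNReal.tsum_prod']
    refine (ENNReal.tsum_le_tsum hn).trans ?_
    rw [ENNReal.tsum_geometric_add_one]
    simp [ENNReal.one_sub_inv_two, ENNReal.inv_mul_cancel]
  simp_rw [← hg]
  rw [← ENNReal.toReal_sum fun a _ => hg' a]
  exact ENNReal.toReal_le_of_le_ofReal zero_le_one (by simpa using htot)

/-- If `w` fails a test, the elements of `A` below `w` have programs that are shorter than their
measure allows by an arbitrarily large amount. -/
theorem exists_short_programs {E : Set (ℕ × S2 × S2)} (hE : IsUniversalEnumeration E)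
    (hP : IsComputableProb P) (hA : ComputablePred fun x : S2 => x ∈ A)
    (hA1 : ComparableOrDisjoint A) {w : Omega × Omega} (hj : IsJoinOfPrefixes A w)
    (hw : w ∉ randomSet P) :
    ∃ c : ℕ, ∀ n : ℕ, ∃ x ∈ prefixesIn A w, 2 ^ n * (P (box x)).toReal ≤ 1 ∧
      ∀ l : ℕ, (2⁻¹ : ℝ) ^ l < 2 ^ n * (P (box x)).toReal →
        Km (optimalFun E) (ofFin x) ≤ ((l + c : ℕ) : ℕ∞) := by
  classical
  obtain ⟨U, hU, hwU⟩ : ∃ U, IsTest P U ∧ w ∈ testLimit U := by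
    simpa [randomSet] using hw
  obtain ⟨R, hR, hRU⟩ := rePred_iff_exists.1 hU.re
  let g : ℕ × S2 → ℝ := fun a =>
    if MinListed R A a then ((2 ^ a.1 : ℕ) : ℝ) * (P (box a.2)).toReal else 0
  have hle : ∀ s : Finset (ℕ × S2), ∑ a ∈ s, g a ≤ 1 :=
    sum_minListed_le hA1 hU fun a m h => (hRU a).2 ⟨m, h⟩
  have hg0 : ∀ a, 0 ≤ g a := fun a => by
    simp only [g]
    split_ifs <;> positivity
  have hD := computablePred_minListed hR hA
  have hg : ComputableReal g := by
    have h1 : ComputableReal fun a : ℕ × S2 => (P (box a.2)).toReal :=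
      hP.computableReal.comp Computable.snd
    exact ComputableReal.ite hD (h1.nat_mul (c := fun a : ℕ × S2 => 2 ^ a.1)
      (Primrec.two_pow.to_comp.comp Computable.fst)) ComputableReal.zero
  have hlo : ComputableReal fun a : ℕ × S2 => ∑ b ∈ below (ℕ × S2) (Encodable.encode a), g b :=
    ComputableReal.sum_below (f := fun (_ : ℕ × S2) b => g b) Computable.encode
      (hg.comp Computable.snd)
  have hhi : ∀ a : ℕ × S2, ∑ b ∈ below (ℕ × S2) (Encodable.encode a), g b + g a =
      ∑ b ∈ insert a (below (ℕ × S2) (Encodable.encode a)), g b := by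
    intro a
    rw [Finset.sum_insert (by simp [mem_below]), add_comm]
  have hmono : ∀ a b : ℕ × S2, Encodable.encode a < Encodable.encode b →
      ∑ b ∈ below (ℕ × S2) (Encodable.encode a), g b + g a ≤
        ∑ a ∈ below (ℕ × S2) (Encodable.encode b), g a := by
    intro a b hab
    rw [hhi]
    refine Finset.sum_le_sum_of_subset_of_nonneg (fun v hv => ?_) fun v _ _ => hg0 v
    rw [Finset.mem_insert, mem_below] at hv
    rw [mem_below]
    rcases hv with rfl | hv
    · exact hab
    · exact hv.trans hab
  -- The intervals are laid end to end in the order of the codes of the pairs `(n, x)`, so only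
  -- equal indices can overlap.
  obtain ⟨c, hc⟩ := exists_Km_le_of_intervals hE (D := MinListed R A) hD.to_re hlo (hlo.add hg)
    (out := fun a => a.2) Computable.snd (fun a _ => Finset.sum_nonneg fun b _ => hg0 b)
    (fun a _ => by rw [hhi]; exact hle _)
    (fun a b _ _ h1 h2 => by
      rcases lt_trichotomy (Encodable.encode a) (Encodable.encode b) with h | h | h
      · exact absurd h2 (not_lt.2 (hmono a b h))
      · rw [Encodable.encode_injective h]
        exact Comp2.of_le_ofFin le_rfl
      · exact absurd h1 (not_lt.2 (hmono b a h)))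
  refine ⟨c, fun n => ?_⟩
  simp only [testLimit, mem_iInter] at hwU
  obtain ⟨y, hyU, hyw⟩ := mem_iUnion₂.1 (hwU (2 * (n + 1)) (by simp; omega))
  obtain ⟨m, hm⟩ := (hRU _).1 hyU
  obtain ⟨x, hx, hyx, hlen⟩ := exists_mem_prefixesIn_of_join hA1 hj hyw m
  -- The element `x` is listed but perhaps not minimal; a minimal listed prefix of it still lies
  -- below `w`.
  obtain ⟨v, hvx, hv, hmin⟩ := exists_minimal_prefix (p := Listed R A (2 * (n + 1))) (x := x)
    ⟨hx.1, y, hyx, m, hlen, hm⟩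
  have hDv : MinListed R A (n, v) := ⟨hv, fun u hu hu' => hmin u hu' hu⟩
  have hgv : g (n, v) = 2 ^ n * (P (box v)).toReal := by
    simp [g, hDv]
  refine ⟨v, ⟨hv.1, hvx.trans hx.2⟩, ?_, fun l hl => hc (n, v) hDv l ?_⟩
  · rw [← hgv]
    simpa using hle {(n, v)}
  · rw [add_sub_cancel_left, hgv]
    exact hl

end Converse

end ProductKm

namespace ProductKm

theorem Word.exists_fin_of_length {p : Word} {k : ℕ} (h : p.length = k) :
    ∃ s : List Bool, p = Word.fin s ∧ s.length = k := by
  rcases p with s | w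
  · exact ⟨s, rfl, ENat.natCast_inj.1 h⟩
  · exact absurd h (by simp [Word.length])

/-! ### Chaining a program for `y` with a program for `x` given `y`. -/

section Composition

variable {E : Set (ℕ × S2 × S2)} (hE : IsUniversalEnumeration E)

variable (E) in
/-- The optimal relation, with the empty output added everywhere. -/
def optimalRel' : Set (S2 × S2) := {a | a ∈ optimalRel E ∨ a.2 = empty2}

variable (E) in
/-- `(p, q) ↦ (u(p, y), y)` with `y = u(q, λ)`, first components of `u` being taken. -/
def chainRel : Set (S2 × S2) := {a | ∃ y e f : List Bool, (y <+: a.2.2 ∧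
  ((a.1.1, y), (a.2.1, e)) ∈ optimalRel' E) ∧ ((a.1.2, []), (a.2.2, f)) ∈ optimalRel' E}

include hE

theorem optimalRel'_consistent : Consistent (optimalRel' E) := by
  rintro ⟨p, x⟩ hx ⟨q, y⟩ hy hpq
  rcases hx with hx | hx
  · rcases hy with hy | hy
    · exact optimalRel_consistent hE _ hx _ hy hpq
    · simp only at hy ⊢
      exact hy ▸ (Comp2.empty_left _).symm
  · simp only at hx ⊢
    exact hx ▸ Comp2.empty_left _

theorem exists_output {x p : S2} (h : ofFin x ≤ optimalFun E (ofFin p)) :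
    ∃ q y : S2, ofFin q ≤ ofFin p ∧ (q, y) ∈ optimalRel' E ∧ x.1 <+: y.1 := by
  rcases ((le_lub_iff (optimalFun_isLUB hE _)).1 h).1 with h | ⟨y, ⟨q, hq, hy⟩, hxy⟩
  -- An empty `x.1` may lie below the join without any listed output; the empty outputs added in
  -- `optimalRel'` supply the witness.
  · exact ⟨p, empty2, le_rfl, Or.inr rfl, by rw [h]; exact List.nil_prefix⟩
  · exact ⟨q, y, hq, Or.inl hy, hxy⟩

theorem rePred_optimalRel' : REPred fun a : S2 × S2 => a ∈ optimalRel' E :=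
  (rePred_optimalRel hE).or (Primrec.eq.computablePred.comp
    (Computable.snd.pair (Computable.const empty2))).to_re

theorem rePred_chainRel : REPred fun a : S2 × S2 => a ∈ chainRel E := by
  have hy : Computable fun b : (((S2 × S2) × List Bool) × List Bool) × List Bool => b.1.1.2 :=
    Computable.snd.comp (Computable.fst.comp Computable.fst)
  have he : Computable fun b : (((S2 × S2) × List Bool) × List Bool) × List Bool => b.1.2 :=
    Computable.snd.comp Computable.fst
  have hp : Computable fun b : (((S2 × S2) × List Bool) × List Bool) × List Bool => b.1.1.1.1 :=
    Computable.fst.comp (Computable.fst.comp (Computable.fst.comp Computable.fst))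
  have hx : Computable fun b : (((S2 × S2) × List Bool) × List Bool) × List Bool => b.1.1.1.2 :=
    Computable.snd.comp (Computable.fst.comp (Computable.fst.comp Computable.fst))
  have h1 : REPred fun b : (((S2 × S2) × List Bool) × List Bool) × List Bool =>
      b.1.1.2 <+: b.1.1.1.2.2 :=
    (computablePred_prefix.comp (hy.pair (Computable.snd.comp hx))).to_re
  have h2 := (rePred_optimalRel' hE).comp (((Computable.fst.comp hp).pair hy).pair
    ((Computable.fst.comp hx).pair he))
  have h3 := (rePred_optimalRel' hE).comp (((Computable.snd.comp hp).pair
    (Computable.const [])).pair ((Computable.snd.comp hx).pair Computable.snd))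
  exact REPred.ex (p := fun (a : S2 × S2) (y : List Bool) => ∃ e f : List Bool, (y <+: a.2.2 ∧
      ((a.1.1, y), (a.2.1, e)) ∈ optimalRel' E) ∧ ((a.1.2, []), (a.2.2, f)) ∈ optimalRel' E)
    (REPred.ex (p := fun (b : (S2 × S2) × List Bool) (e : List Bool) => ∃ f : List Bool,
      (b.2 <+: b.1.2.2 ∧ ((b.1.1.1, b.2), (b.1.2.1, e)) ∈ optimalRel' E) ∧
        ((b.1.1.2, []), (b.1.2.2, f)) ∈ optimalRel' E)
      (REPred.ex (p := fun (b : ((S2 × S2) × List Bool) × List Bool) (f : List Bool) =>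
        (b.1.2 <+: b.1.1.2.2 ∧ ((b.1.1.1.1, b.1.2), (b.1.1.2.1, b.2)) ∈ optimalRel' E) ∧
          ((b.1.1.1.2, []), (b.1.1.2.2, f)) ∈ optimalRel' E) ((h1.and h2).and h3)))

/-- Comparable second programs produce comparable `y` and `y'`. The conditions used are prefixes of
these, hence comparable too, and consistency of `u` on them makes the first outputs comparable. -/
theorem chainRel_consistent : Consistent (chainRel E) := by
  rintro ⟨⟨p, q⟩, x, y⟩ ⟨y₀, e, f, ⟨hy₀, h1⟩, h2⟩ ⟨⟨p', q'⟩, x', y'⟩ ⟨y₀', e', f', ⟨hy₀', h1'⟩, h2'⟩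
    ⟨hp, hq⟩
  have hyy : Comp1 y y' :=
    (optimalRel'_consistent hE _ h2 _ h2' ⟨hq, Or.inl List.prefix_rfl⟩).1
  obtain ⟨r, hr, hr'⟩ := hyy.exists_join
  exact ⟨(optimalRel'_consistent hE _ h1 _ h1' ⟨hp, Comp1.of_le
    (((Word.fin_le_fin _ _).2 hy₀).trans hr) (((Word.fin_le_fin _ _).2 hy₀').trans hr')⟩).1, hyy⟩

/-- Shortest programs for `x` given `y` and for `y` form a pair of programs for the chained
function. The first uses only a finite prefix of `y`, which the output of the second extends. -/
theorem exists_Km2_le_chain : ∃ c : ℕ, ∀ x : S2,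
    Km2 (optimalFun E) (ofFin x) ≤ KmCond (optimalFun E) (Word.fin x.1) (Word.fin x.2) +
      Km1 (optimalFun E) (Word.fin x.2) + c := by
  have h0 : ∀ p, (p, empty2) ∈ chainRel E := fun p =>
    ⟨[], [], [], ⟨List.prefix_rfl, Or.inr rfl⟩, Or.inr rfl⟩
  obtain ⟨i, hi⟩ := optimalFun_dominates hE (rePred_chainRel hE) h0 (chainRel_consistent hE)
  refine ⟨i + 1, fun x => ?_⟩
  rcases eq_or_ne (KmCond (optimalFun E) (Word.fin x.1) (Word.fin x.2)) ⊤ with h1 | h1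
  · simp [h1]
  rcases eq_or_ne (Km1 (optimalFun E) (Word.fin x.2)) ⊤ with h2 | h2
  · simp [h2]
  have ne_of : ∀ {s : Set ℕ∞}, sInf s ≠ ⊤ → s.Nonempty := fun {s} h => by
    by_contra hs
    rw [Set.not_nonempty_iff_eq_empty] at hs
    exact h (by rw [hs, sInf_empty])
  obtain ⟨k, hk⟩ := ENat.ne_top_iff_exists.1 h1
  obtain ⟨l, hl⟩ := ENat.ne_top_iff_exists.1 h2
  obtain ⟨p, hp, hpk⟩ := csInf_mem (ne_of h1)
  obtain ⟨q, hq, hql⟩ := csInf_mem (ne_of h2)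
  obtain ⟨p, rfl, hpl⟩ := Word.exists_fin_of_length (hpk.symm.trans hk.symm)
  obtain ⟨q, rfl, hql'⟩ := Word.exists_fin_of_length (hql.symm.trans hl.symm)
  obtain ⟨⟨p', y₀⟩, ⟨x', e⟩, ⟨hp', hy₀⟩, hout, hx⟩ :=
    exists_output hE (x := (x.1, [])) (p := (p, x.2)) hp
  obtain ⟨⟨q', n⟩, ⟨y', f⟩, ⟨hq', hn⟩, hout', hy⟩ :=
    exists_output hE (x := (x.2, [])) (p := (q, [])) hq
  obtain rfl : n = [] := List.prefix_nil.1 ((Word.fin_le_fin _ _).1 hn)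
  have hp' : p' <+: p := (Word.fin_le_fin _ _).1 hp'
  have hq' : q' <+: q := (Word.fin_le_fin _ _).1 hq'
  have hmem : ((p', q'), (x', y')) ∈ chainRel E :=
    ⟨y₀, e, f, ⟨((Word.fin_le_fin _ _).1 hy₀).trans hy, hout⟩, hout'⟩
  have h3 := hi _ _ hmem
  have h4 : ofFin x ≤ ofFin (x', y') := ⟨hx, hy⟩
  have h5 : Km2 (optimalFun E) (ofFin x) ≤
      (((i + 1 + p'.length + q'.length : ℕ)) : ℕ∞) := by
    refine sInf_le_of_le ⟨_, h4.trans h3, rfl⟩ (le_of_eq ?_)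
    simp only [ofFin, Word.length, List.length_append, List.length_replicate, List.length_cons]
    norm_cast
    ring
  refine h5.trans ?_
  rw [← hk, ← hl]
  norm_cast
  have := hp'.length_le
  have := hq'.length_le
  omega

end Composition

/-! ### Passage to extended real values. -/

section EReal

theorem toE_natCast (k : ℕ) : toE (k : ℕ∞) = ((k : ℝ) : EReal) := by
  rw [toE, ENat.toENNReal_coe, ← ENNReal.ofReal_natCast, EReal.coe_ennreal_ofReal,
    max_eq_left (Nat.cast_nonneg k)]

theorem toE_top : toE ⊤ = ⊤ := by
  simp [toE]

theorem log2_of_pos {p : ℝ≥0∞} (hp : 0 < p) : log2 p = ((Real.logb 2 p.toReal : ℝ) : EReal) := by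
  rw [log2, if_neg hp.ne']

theorem logb_two_inv_pow (n : ℕ) : Real.logb 2 ((2⁻¹ : ℝ) ^ n) = -n := by
  rw [Real.logb_pow, Real.logb_inv, Real.logb_self_eq_one one_lt_two]
  ring

theorem supAbsFinite_sub {A : Set S2} {K L : S2 → ℕ∞} {C : ℝ}
    (h : ∀ x ∈ A, ∃ k l : ℕ, K x = k ∧ L x = l ∧ |(k : ℝ) - l| ≤ C) :
    SupAbsFinite A fun x => toE (K x) - toE (L x) := by
  refine ⟨C, fun x hx => ?_⟩
  obtain ⟨k, l, hk, hl, hC⟩ := h x hx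
  simp only [hk, hl, toE_natCast]
  rw [abs_le] at hC
  exact ⟨by exact_mod_cast hC.1, by exact_mod_cast hC.2⟩

theorem supAbsFinite_log_add {A : Set S2} {P : Measure (Omega × Omega)} {K : S2 → ℕ∞} {C : ℝ}
    (h : ∀ x ∈ A, 0 < P (box x) ∧ ∃ k : ℕ, K x = k ∧
      |Real.logb 2 (P (box x)).toReal + k| ≤ C) :
    SupAbsFinite A fun x => log2 (P (box x)) + toE (K x) := by
  refine ⟨C, fun x hx => ?_⟩
  obtain ⟨h0, k, hk, hC⟩ := h x hx
  simp only [hk, toE_natCast, log2_of_pos h0]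
  rw [abs_le] at hC
  exact ⟨by exact_mod_cast hC.1, by exact_mod_cast hC.2⟩

end EReal

/-! ### The two bounds combined along a point. -/

section Main

variable {E : Set (ℕ × S2 × S2)} (hE : IsUniversalEnumeration E)
  {P : Measure (Omega × Omega)} [IsProbabilityMeasure P] (hP : IsComputableProb P)
  {A : Set S2} (hA : ComputablePred fun x : S2 => x ∈ A) (hA1 : ComparableOrDisjoint A)
  {w : Omega × Omega}
include hE hP hA hA1

/-- Along a random pair, `Km²` and `Km` are equal to `-log P` up to a bounded term. -/
theorem exists_bound_of_random (hw : w ∈ randomSet P) :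
    ∃ C : ℝ, ∀ x ∈ prefixesIn A w, 0 < P (box x) ∧ ∃ k l : ℕ,
      Km (optimalFun E) (ofFin x) = k ∧ Km2 (optimalFun E) (ofFin x) = l ∧ l ≤ k ∧
        -C ≤ Real.logb 2 (P (box x)).toReal + l ∧ Real.logb 2 (P (box x)).toReal + k ≤ C := by
  obtain ⟨c, hc⟩ := exists_Km_le_neg_log hE hP hA hA1
  obtain ⟨n, hn⟩ := exists_le_of_random hE hP hA hA1 hw
  refine ⟨n + c + 1, fun x hx => ?_⟩
  have hpos := pos_of_random hw hx.2
  have hpos' : 0 < (P (box x)).toReal := ENNReal.toReal_pos hpos.ne' (measure_ne_top _ _)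
  refine ⟨hpos, ?_⟩
  -- `m` is the integer with `2 ^ -(m + 1) < P(x) ≤ 2 ^ -m`, so `m + 1` is an admissible length in
  -- the coding bound.
  obtain ⟨m, hm1, hm2⟩ := exists_nat_pow_near_of_lt_one hpos'
    (ENNReal.toReal_le_of_le_ofReal zero_le_one (by simpa using prob_le_one))
    (by norm_num : (0 : ℝ) < 2⁻¹) (by norm_num)
  have h1 := hc x hx.1 (m + 1) hm1
  obtain ⟨k, hk⟩ := ENat.ne_top_iff_exists.1 (ne_top_of_le_ne_top (ENat.natCast_ne_top _) h1)
  have h2 := Km2_le_Km (optimalFun E) (ofFin x)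
  rw [← hk] at h1 h2
  obtain ⟨l, hl⟩ := ENat.ne_top_iff_exists.1 (ne_top_of_le_ne_top (ENat.natCast_ne_top _) h2)
  rw [← hl] at h2
  refine ⟨k, l, hk.symm, hl.symm, by exact_mod_cast h2, ?_, ?_⟩
  · have hne : {n | ∃ p : Word2, ofFin x ≤ optimalFun E p ∧
        n = p.1.length + p.2.length}.Nonempty := by
      by_contra hs
      rw [Set.not_nonempty_iff_eq_empty] at hs
      rw [Km2, hs, sInf_empty] at hl
      exact ENat.natCast_ne_top _ hl
    obtain ⟨p, hp, hpl⟩ := csInf_mem hne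
    have hpl' : p.1.length + p.2.length = l := hpl.symm.trans hl.symm
    -- The minimum is finite, so both optimal programs are finite strings, as the lower bound
    -- requires.
    obtain ⟨a, ha⟩ := ENat.ne_top_iff_exists.1
      (ne_top_of_le_ne_top (ENat.natCast_ne_top l) (hpl' ▸ le_self_add : p.1.length ≤ l))
    obtain ⟨b, hb⟩ := ENat.ne_top_iff_exists.1
      (ne_top_of_le_ne_top (ENat.natCast_ne_top l) (hpl' ▸ le_add_self : p.2.length ≤ l))
    obtain ⟨s, hs, hsa⟩ := Word.exists_fin_of_length ha.symm
    obtain ⟨t, ht, htb⟩ := Word.exists_fin_of_length hb.symm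
    have hst : p = ofFin (s, t) := Prod.ext hs ht
    rw [← ha, ← hb] at hpl'
    have hab : a + b = l := by exact_mod_cast hpl'
    have h3 := hn x hx (s, t) (hst ▸ hp)
    simp only [hsa, htb, hab] at h3
    have h4 := Real.logb_le_logb_of_le one_lt_two (by positivity) h3
    rw [logb_two_inv_pow] at h4
    push_cast at h4
    linarith [(Nat.cast_nonneg c : (0 : ℝ) ≤ c)]
  · have h3 := Real.logb_le_logb_of_le one_lt_two hpos' hm2
    rw [logb_two_inv_pow] at h3
    have h4 : (k : ℝ) ≤ m + 1 + c := by exact_mod_cast h1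
    linarith [(Nat.cast_nonneg n : (0 : ℝ) ≤ n)]

/-- Only the lower bound on `log P + K` is used, and it passes from `K` to anything larger; a
general `K` below `Km` covers both complexities at once. -/
theorem random_of_supAbsFinite {K : S2 → ℕ∞} (hK : ∀ x, K x ≤ Km (optimalFun E) (ofFin x))
    (h : SupAbsFinite (prefixesIn A w) fun x => log2 (P (box x)) + toE (K x))
    (hj : IsJoinOfPrefixes A w) : w ∈ randomSet P := by
  by_contra hw
  obtain ⟨C, hC⟩ := h
  obtain ⟨c, hc⟩ := exists_short_programs hE hP hA hA1 hj hw
  -- The short program gives `log P(x) + K(x) ≤ 1 + c - n`, which is below `-C` for this `n`.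
  obtain ⟨n, hn⟩ := exists_nat_gt (C + 1 + c)
  obtain ⟨x, hx, hle, hx'⟩ := hc n
  have hlow : -(C : EReal) ≤ log2 (P (box x)) + toE (K x) := (hC x hx).1
  have hpos : 0 < P (box x) := by
    by_contra h0
    have h0 : P (box x) = 0 := by simpa using h0
    simp only [log2, if_pos h0, EReal.bot_add, le_bot_iff] at hlow
    exact EReal.coe_ne_bot (-C) (by exact_mod_cast hlow)
  have hpos' : 0 < (P (box x)).toReal := ENNReal.toReal_pos hpos.ne' (measure_ne_top _ _)
  obtain ⟨m, hm1, hm2⟩ := exists_nat_pow_near_of_lt_one (by positivity) hle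
    (by norm_num : (0 : ℝ) < 2⁻¹) (by norm_num)
  have h1 := (hK x).trans (hx' (m + 1) hm1)
  obtain ⟨k, hk⟩ := ENat.ne_top_iff_exists.1 (ne_top_of_le_ne_top (ENat.natCast_ne_top _) h1)
  rw [← hk] at h1
  rw [← hk, toE_natCast, log2_of_pos hpos] at hlow
  have hlow' : -C ≤ Real.logb 2 (P (box x)).toReal + k := by exact_mod_cast hlow
  have h3 := Real.logb_le_logb_of_le one_lt_two (by positivity) hm2
  rw [logb_two_inv_pow, Real.logb_mul (by positivity) hpos'.ne', Real.logb_pow,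
    Real.logb_self_eq_one one_lt_two] at h3
  have h4 : (k : ℝ) ≤ m + 1 + c := by exact_mod_cast h1
  linarith

end Main

theorem supFinite_chain {E : Set (ℕ × S2 × S2)} (hE : IsUniversalEnumeration E) {B : Set S2}
    (h : SupAbsFinite B fun x =>
      toE (Km (optimalFun E) (ofFin x)) - toE (Km2 (optimalFun E) (ofFin x))) :
    SupFinite B fun x => toE (Km (optimalFun E) (ofFin x))
      - toE (KmCond (optimalFun E) (Word.fin x.1) (Word.fin x.2))
      - toE (Km1 (optimalFun E) (Word.fin x.2)) := by
  obtain ⟨C, hC⟩ := h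
  obtain ⟨c, hc⟩ := exists_Km2_le_chain hE
  refine ⟨C + c, fun x hx => ?_⟩
  have h1 := (hC x hx).2
  have h2 := hc x
  simp only at h1 ⊢
  generalize Km (optimalFun E) (ofFin x) = K at *
  generalize Km2 (optimalFun E) (ofFin x) = L at *
  generalize KmCond (optimalFun E) (Word.fin x.1) (Word.fin x.2) = a at *
  generalize Km1 (optimalFun E) (Word.fin x.2) = b at *
  induction a using ENat.recTopCoe with
  -- Subtracting `⊤` gives `⊥` in `EReal`, whatever the value of `K`, so the bound is trivial.
  | top => simp [toE_top]
  | coe a =>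
  induction b using ENat.recTopCoe with
  | top => simp [toE_top]
  | coe b =>
  obtain ⟨l, rfl⟩ := ENat.ne_top_iff_exists.1
    (ne_top_of_le_ne_top (ENat.natCast_ne_top (a + b + c)) (by exact_mod_cast h2))
  rw [toE_natCast] at h1
  induction K using ENat.recTopCoe with
  | top =>
    rw [toE_top, EReal.top_sub_coe, top_le_iff] at h1
    exact absurd h1 (EReal.coe_ne_top _)
  | coe k =>
  rw [toE_natCast] at h1
  simp only [toE_natCast]
  have h3 : (k : ℝ) - l ≤ C := by exact_mod_cast h1
  have h4 : (l : ℝ) ≤ a + b + c := by exact_mod_cast h2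
  have h5 : (k : ℝ) - a - b ≤ C + c := by linarith
  exact_mod_cast h5

end ProductKm

theorem mainTheorem8
    (E : Set (ℕ × S2 × S2)) (hE : IsUniversalEnumeration E)
    (P : Measure (Omega × Omega)) [IsProbabilityMeasure P] (hP : IsComputableProb P)
    (A : Set S2) (hA : ComputablePred fun x : S2 => x ∈ A)
    (hA1 : ComparableOrDisjoint A) (hA2 : DifferencesCovered A)
    (w : Omega × Omega) :
    -- the coding bound for `Km`, and its converse
    (w ∈ randomSet P → SupAbsFinite (prefixesIn A w)
      fun x => log2 (P (box x)) + toE (Km (optimalFun E) (ofFin x))) ∧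
    ((SupAbsFinite (prefixesIn A w)
      fun x => log2 (P (box x)) + toE (Km (optimalFun E) (ofFin x))) →
      IsJoinOfPrefixes A w → w ∈ randomSet P) ∧
    -- the same for `Km²`
    (w ∈ randomSet P → SupAbsFinite (prefixesIn A w)
      fun x => log2 (P (box x)) + toE (Km2 (optimalFun E) (ofFin x))) ∧
    ((SupAbsFinite (prefixesIn A w)
      fun x => log2 (P (box x)) + toE (Km2 (optimalFun E) (ofFin x))) →
      IsJoinOfPrefixes A w → w ∈ randomSet P) ∧
    -- `Km` and `Km²` agree up to a bounded term along a random pair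
    (w ∈ randomSet P → SupAbsFinite (prefixesIn A w)
      fun x => toE (Km (optimalFun E) (ofFin x)) - toE (Km2 (optimalFun E) (ofFin x))) ∧
    -- and this agreement bounds `Km(x, y) - Km(x | y) - Km(y)` from above
    ((SupAbsFinite (prefixesIn A w)
      fun x => toE (Km (optimalFun E) (ofFin x)) - toE (Km2 (optimalFun E) (ofFin x))) →
      SupFinite (prefixesIn A w)
        fun x => toE (Km (optimalFun E) (ofFin x))
          - toE (KmCond (optimalFun E) (Word.fin x.1) (Word.fin x.2))
          - toE (Km1 (optimalFun E) (Word.fin x.2))) := by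
  have hK2 : ∀ x : S2, Km2 (optimalFun E) (ofFin x) ≤ Km (optimalFun E) (ofFin x) :=
    fun x => Km2_le_Km _ _
  refine ⟨fun hw => ?_, random_of_supAbsFinite hE hP hA hA1 fun _ => le_rfl, fun hw => ?_,
    random_of_supAbsFinite hE hP hA hA1 hK2, fun hw => ?_, supFinite_chain hE⟩
  all_goals
    obtain ⟨C, hC⟩ := exists_bound_of_random hE hP hA hA1 hw
  · refine supAbsFinite_log_add (C := C) fun x hx => ?_
    obtain ⟨h0, k, l, hk, hl, hlk, h1, h2⟩ := hC x hx
    have h3 : (l : ℝ) ≤ k := by exact_mod_cast hlk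
    exact ⟨h0, k, hk, abs_le.2 ⟨by linarith, h2⟩⟩
  · refine supAbsFinite_log_add (C := C) fun x hx => ?_
    obtain ⟨h0, k, l, hk, hl, hlk, h1, h2⟩ := hC x hx
    have h3 : (l : ℝ) ≤ k := by exact_mod_cast hlk
    exact ⟨h0, l, hl, abs_le.2 ⟨h1, by linarith⟩⟩
  · refine supAbsFinite_sub (C := 2 * C) fun x hx => ?_
    obtain ⟨h0, k, l, hk, hl, hlk, h1, h2⟩ := hC x hx
    have h3 : (l : ℝ) ≤ k := by exact_mod_cast hlk
    exact ⟨k, l, hk, hl, abs_le.2 ⟨by linarith, by linarith⟩⟩
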